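/- **Model.** Let $\mathsf H,\mathsf r,\mathsf N$ be integers with $\mathsf r\ge 1$, $\mathsf H\ge 2\mathsf r$ and $\mathsf N\ge \mathsf K:=\binom{\mathsf H}{\mathsf r}$. In the combination network a server holding $\mathsf N$ files $F_1,\dots,F_{\mathsf N}$ of $\mathsf B$ independent uniform bits each is connected to $\mathsf H$ relays, and there is one user for each set of $\mathsf r$ relays, connected to exactly these relays ($\mathsf K$ users). We write $\mathcal H_k$ for the set of relays of user $k$. With an uncoded placement each user copies at most $\mathsf M\mathsf B$ bits of the files into its cache, before the demands are known. Then, for a demand vector $\mathbf d=(d_k)_k\in[\mathsf N]^{\mathsf K}$ known to all nodes, the server sends a message to each relay, each relay sends to each of its users a message that is a function of what the relay has received, and user $k$ has to recover $F_{d_k}$ from its cache and the messages of its relays. The max link-load is the largest number of bits sent on a link, divided by $\mathsf B$. Let $\mathsf R^\star_{\mathrm u}(\mathsf M)$ be the infimum of the $R$ such that for every $\varepsilon>0$ there are a file size $\mathsf B\geq 1$ and an uncoded placement such that every demand vector can be served with max link-load at most $R$ and error probability at most $\varepsilon$. **Theorem.** Let $\mathsf M=\mathsf N/\mathsf K$.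 Then $$\mathsf R^\star_{\mathrm u}(\mathsf M)\;\le\; L:=\frac{1}{2\mathsf H}\left(\mathsf K-1-\binom{\mathsf H-\mathsf r}{\mathsf r}\right)+\frac{\binom{2\mathsf r-1}{\mathsf r-1}}{(2\mathsf r-1)\,\mathsf K}\binom{\mathsf H-1}{2\mathsf r-1}.$$ Moreover, if $2\mathsf r-1=p^v$ with $p$ prime and $v\ge1$, or $2\mathsf r-1=pq$ with distinct primes $p,q$, then the load $L$ is achieved by the interference elimination scheme described below. That is, all choices required below for its data can be made (depending only on $\mathsf H,\mathsf r$) in such a way that for every $\delta>0$ there is $b_0$ such that for all $b\ge b_0$ and all $P\ge1$ divisible by $\mathsf r!$ there is an admissible prime $\ell$ with which the scheme, for files of $\mathsf B=\mathsf KPb$ bits and caches of $\mathsf M\mathsf B$ bits, serves every demand vector without error and with max link-load at most $L+\delta$. **The interference elimination scheme.** *Placement.* Each file $F_i$ is split into $\mathsf K$ sub-files $F_{i,\{k\}}$ of $Pb$ bits ($P$ packets of $b$ bits), and user $k$ stores $F_{i,\{k\}}$ for all $i$. *Messages.* For each pair $J=\{k,k'\}$ of users let $W_J=F_{d_k,\{k'\}}\oplus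 F_{d_{k'},\{k\}}$. *Pairs with a common relay.* If $k$ and $k'$ have common relays, $W_J$ is split into equally many bits for each of them, which are sent directly to these relays. *Pairs without a common relay.* For each set $A$ of $2\mathsf r$ relays, the pairs $\{k,k'\}$ with $\mathcal H_k\cap\mathcal H_{k'}=\emptyset$ and $\mathcal H_k\cup\mathcal H_{k'}= A$ are divided into $\binom{2\mathsf r-1}{\mathsf r-1}/(2\mathsf r-1)$ groups of $2\mathsf r-1$ pairs, such that for each group $G$ the $2\mathsf r\times2\mathsf r$ matrix $\mathbb C_G$ over $\mathbb Q$, with columns indexed by $A$, is invertible, where $\mathbb C_G$ has one row of ones and, for each pair in $G$, the indicator row of $\mathcal H_k$ for that user $k$ of the pair who is connected to the last relay of $A$. Integers $s\ne0$ and $a_{J,h}$ ($J\in G$, $h\in A$) are chosen such that $\mathbb C_G\,(a_{J,h})_{h\in A}$ equals $s$ in the row of $J$ and $0$ in all other rows. Let $\ell$ be a prime with $\ell\ge2^b$ and $\ell\nmid s$ (an admissible prime), and identify packets of $b$ bits with elements of $\mathbb F_\ell$ by reading them as binary numbers. For each $A$, each group $G$ and each packet position, the server sends $\sum_{J\in G}a_{J,h}W_J\in\mathbb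 F_\ell$, written with $\lceil\log_2\ell\rceil$ bits, to each relay $h\in A$. *Relays* forward what they receive. *Decoding.* User $k$ collects the parts of $W_{\{k,k'\}}$ if $k$ and $k'$ have a common relay; otherwise it sums the codewords for the group of $\{k,k'\}$ over its relays and divides the sum by $s$ or $-s$, according to whether $k$ or $k'$ is connected to the last relay of $A$. From $W_{\{k,k'\}}$ and $F_{d_{k'},\{k\}}$ it obtains $F_{d_k,\{k'\}}$. -/

import Mathlib

open scoped Nat

namespace CombinationNetwork

/-! ## The network and caching schemes with uncoded placement -/

/-- Bits, with exclusive or as addition. -/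
abbrev Bit : Type := ZMod 2

/-- The users: one for each set of `r` of the `H` relays, namely the set of relays it is
connected to. There are `H.choose r` of them. -/
abbrev User (H r : ℕ) : Type := {S : Finset (Fin H) // S.card = r}

/-- The `N` files; the bits of each file are labelled by the finite type `β`, so that the
file size is `Fintype.card β` bits. -/
abbrev Library (N : ℕ) (β : Type) : Type := Fin N → β → Bit

/-- An uncoded placement: every user copies some bits of the files into its cache. -/
abbrev UncodedPlacement (N H r : ℕ) (β : Type) : Type := User H r → Finset (Fin N × β)

/-- What user `k` finds in its cache. -/
def cacheContent {N H r : ℕ} {β : Type} (Z : UncodedPlacement N H r β)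
    (F : Library N β) (k : User H r) : Z k → Bit :=
  fun x => F x.1.1 x.1.2

/-- A delivery phase (for one demand vector) after the placement `Z`. The bits of the message
from the server to relay `h` are labelled by `relayIdx h`, those of the message from relay `h` to
user `k` by `linkIdx h k`. A relay only knows what it has received; a user decodes from its cache
and from the messages of the relays it is connected to. -/
structure Delivery {N H r : ℕ} {β : Type} (Z : UncodedPlacement N H r β) where
  relayIdx : Fin H → Type
  linkIdx : Fin H → User H r → Type
  relayFintype : ∀ h, Fintype (relayIdx h)
  linkFintype : ∀ h k, Fintype (linkIdx h k)
  enc : Library N β → ∀ h, relayIdx h → Bit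
  fwd : ∀ h k, (relayIdx h → Bit) → linkIdx h k → Bit
  dec : ∀ k : User H r, (Z k → Bit) →
    (∀ h : {h : Fin H // h ∈ k.1}, linkIdx h.1 k → Bit) → β → Bit

namespace Delivery

variable {N H r : ℕ} {β : Type} {Z : UncodedPlacement N H r β}

/-- The file that user `k` reconstructs. -/
def output (D : Delivery Z) (F : Library N β) (k : User H r) : β → Bit :=
  D.dec k (cacheContent Z F k) (fun h => D.fwd h.1 k (D.enc F h.1))

/-- The largest number of bits that is sent over a link of the network. -/
def maxLinkBits (D : Delivery Z) : ℕ :=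
  Finset.univ.sup fun h : Fin H =>
    max (@Fintype.card (D.relayIdx h) (D.relayFintype h))
      ((Finset.univ.filter fun k : User H r => h ∈ k.1).sup fun k =>
        @Fintype.card (D.linkIdx h k) (D.linkFintype h k))

/-- The max link-load: the largest number of bits on a link, in units of the file size. -/
noncomputable def maxLinkLoad [Fintype β] (D : Delivery Z) : ℝ :=
  (D.maxLinkBits : ℝ) / (Fintype.card β : ℝ)

/-- The probability, for independent and uniformly distributed files, that some user does not
recover the file it demands. -/
noncomputable def errorProb (D : Delivery Z) (d : User H r → Fin N) : ℝ :=
  (Nat.card {F : Library N β // ∃ k, D.output F k ≠ F (d k)} : ℝ) / (Nat.card (Library N β) : ℝ)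

end Delivery

/-- With caches of `M` files, the load `R` can be guaranteed by an uncoded placement: for every
`ε > 0` there are a file size `B` and an uncoded placement within the cache size `M * B` such that
every demand vector can be served with max link-load at most `R` and error probability at
most `ε`. -/
def AchievableUncoded (N H r : ℕ) (M R : ℝ) : Prop :=
  ∀ ε : ℝ, 0 < ε → ∃ B : ℕ, 0 < B ∧ ∃ Z : UncodedPlacement N H r (Fin B),
    (∀ k, ((Z k).card : ℝ) ≤ M * (B : ℝ)) ∧
    ∀ d : User H r → Fin N, ∃ D : Delivery Z, D.maxLinkLoad ≤ R ∧ D.errorProb d ≤ ε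

/-- The optimal max link-load under uncoded placement (`⊤` if no load is achievable). -/
noncomputable def optimalLoadUncoded (N H r : ℕ) (M : ℝ) : EReal :=
  ⨅ (R : ℝ) (_ : AchievableUncoded N H r M R), (R : EReal)

/-! ## The interference elimination scheme -/

/-- The relays that are connected to all users in `J`. -/
def commonRelays {H r : ℕ} (J : Finset (User H r)) : Finset (Fin H) :=
  Finset.univ.filter fun h => ∀ k ∈ J, h ∈ k.1

/-- The pairs of users without a common relay. -/
def separatedPairs (H r : ℕ) : Finset (Finset (User H r)) :=
  Finset.univ.filter fun J => J.card = 2 ∧ commonRelays J = ∅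

/-- The pairs of users without a common relay, all of whose relays are in `A`. -/
def separatedPairsIn {H : ℕ} (r : ℕ) (A : Finset (Fin H)) : Finset (Finset (User H r)) :=
  (separatedPairs H r).filter fun J => ∀ k ∈ J, k.1 ⊆ A

/-- User `k` is connected to the last relay of `A` (for a user whose relays are all in `A`). -/
def IsTop {H r : ℕ} (A : Finset (Fin H)) (k : User H r) : Prop :=
  ∃ l ∈ k.1, ∀ x ∈ A, x ≤ l

instance {H r : ℕ} (A : Finset (Fin H)) (k : User H r) : Decidable (IsTop A k) := by
  unfold IsTop; infer_instance

/-- The matrix of a group `G` of pairs of users: columns are the relays in `A`; the first row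
(`none`) consists of ones, and the row of a pair is the indicator of the relays of that user of
the pair who is connected to the last relay of `A`. -/
def groupMatrix {H r : ℕ} (A : Finset (Fin H)) (G : Finset (Finset (User H r))) :
    Matrix (Option G) A ℚ :=
  fun row i => match row with
    | none => 1
    | some J => if ∃ k ∈ J.1, IsTop A k ∧ i.1 ∈ k.1 then 1 else 0

/-- The number of groups for each set of `2 * r` relays (the division is exact). -/
def groupCount (r : ℕ) : ℕ := (2 * r - 1).choose (r - 1) / (2 * r - 1)

/-- The data of the interference elimination scheme. For each set `A` of `2 * r` relays, the pairs
of users without a common relay and with all relays in `A` are divided into groups of `2 * r - 1`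
pairs whose group matrices have full rank. For a pair `J` of a group, the coefficients
`coef A J h`, `h ∈ A`, solve the linear system with this matrix whose right-hand side is a nonzero
number `s` in the row of `J` and zero in all other rows. -/
structure InterferenceCode (H r : ℕ) where
  group : Finset (Fin H) → Fin (groupCount r) → Finset (Finset (User H r))
  group_card : ∀ A, A.card = 2 * r → ∀ g, (group A g).card = 2 * r - 1
  group_subset : ∀ A, A.card = 2 * r → ∀ g, group A g ⊆ separatedPairsIn r A
  group_cover : ∀ A, A.card = 2 * r → ∀ J ∈ separatedPairsIn r A, ∃! g, J ∈ group A g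
  full_rank : ∀ A, A.card = 2 * r → ∀ g, (groupMatrix A (group A g)).rank = 2 * r
  s : ℤ
  s_ne_zero : s ≠ 0
  coef : Finset (Fin H) → Finset (User H r) → Fin H → ℤ
  coef_spec : ∀ A, A.card = 2 * r → ∀ g, ∀ J : group A g,
    (groupMatrix A (group A g)).mulVec (fun i => (coef A J.1 i.1 : ℚ)) =
      Pi.single (some J) (s : ℚ)

/-- Each file is divided into one sub-file per user, each sub-file into `P` packets of `b` bits:
the file size is `H.choose r * P * b`. -/
abbrev PacketIdx (H r P b : ℕ) : Type := User H r × Fin P × Fin b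

/-- The placement of the scheme: user `k` stores its sub-file of each file. -/
def subfilePlacement (N H r P b : ℕ) : UncodedPlacement N H r (PacketIdx H r P b) :=
  fun k => Finset.univ.filter fun x => x.2.1 = k

/-- The coded message of a pair `J = {k, k'}` of users: the exclusive or of the sub-file that `k`
demands and `k'` stores, and of the sub-file that `k'` demands and `k` stores. -/
def pairMessage {N H r P b : ℕ} (d : User H r → Fin N) (F : Library N (PacketIdx H r P b))
    (J : Finset (User H r)) (p : Fin P) (j : Fin b) : Bit :=
  ∑ k ∈ J, ∑ k' ∈ J.erase k, F (d k) (k', p, j)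

/-- A bit string, read as a binary number, as an element of `ZMod q`. -/
def toField (q : ℕ) {n : ℕ} (x : Fin n → Bit) : ZMod q :=
  ∑ j : Fin n, ((x j).val : ZMod q) * 2 ^ (j : ℕ)

/-- The first `n` binary digits of an element of `ZMod q`. -/
def toBits {q : ℕ} (n : ℕ) (y : ZMod q) : Fin n → Bit :=
  fun t => if y.val.testBit t then 1 else 0

/-- The message of a pair with common relays is split packet by packet into equally many pieces,
one for each common relay: packet `p` goes to `h` if the position of `h` among the common relays
is `p` modulo their number. -/
def Carries {H r P : ℕ} (J : Finset (User H r)) (h : Fin H) (p : Fin P) : Prop :=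
  h ∈ commonRelays J ∧
    ((commonRelays J).filter fun x => x < h).card = (p : ℕ) % (commonRelays J).card

instance {H r P : ℕ} (J : Finset (User H r)) (h : Fin H) (p : Fin P) :
    Decidable (Carries J h p) := by
  unfold Carries; infer_instance

/-- Labels of the bits of pair messages that are sent directly to relay `h`. -/
abbrev DirectIdx {H : ℕ} (r P b : ℕ) (h : Fin H) : Type :=
  {x : Finset (User H r) × Fin P × Fin b // x.1.card = 2 ∧ Carries x.1 h x.2.1}

/-- Labels of the codeword bits that are sent to relay `h`: for each set of `2 * r` relays that
contains `h`, each group and each packet there is one element of `ZMod q`, written in binary. -/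
abbrev CodedIdx {H : ℕ} (r P q : ℕ) (h : Fin H) : Type :=
  {A : Finset (Fin H) // A.card = 2 * r ∧ h ∈ A} × Fin (groupCount r) × Fin P × Fin (Nat.clog 2 q)

namespace InterferenceCode

variable {N H r P b : ℕ}

/-- The codeword of the group `g` for relay `h ∈ A`: the linear combination over `ZMod q` of the
pair messages in the group. -/
def codeword (C : InterferenceCode H r) (q : ℕ) (d : User H r → Fin N)
    (F : Library N (PacketIdx H r P b)) (A : Finset (Fin H)) (g : Fin (groupCount r))
    (h : Fin H) (p : Fin P) : ZMod q :=
  ∑ J ∈ C.group A g, (C.coef A J h : ZMod q) * toField q (pairMessage d F J p)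

/-- What user `k` gets by summing the codewords it receives from its relays for the group that
contains `{k, k'}`. -/
def codewordSum (C : InterferenceCode H r) (q : ℕ) (k k' : User H r)
    (y : ∀ h : {h : Fin H // h ∈ k.1}, DirectIdx r P b h.1 ⊕ CodedIdx r P q h.1 → Bit)
    (p : Fin P) : ZMod q :=
  ∑ h : {h : Fin H // h ∈ k.1},
    ∑ A : {A : Finset (Fin H) // A.card = 2 * r ∧ h.1 ∈ A}, ∑ g : Fin (groupCount r),
      if A.1 = k.1 ∪ k'.1 ∧ {k, k'} ∈ C.group A.1 g then
        toField q (fun t => y h (Sum.inr (A, g, p, t))) else 0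

/-- How user `k` recovers the message of the pair `{k, k'}`: it collects the bits if the pair has
a common relay; otherwise it sums the codewords, which gives the message multiplied by `s` or
by `-s`. -/
def recoverMessage (C : InterferenceCode H r) (q : ℕ) (k k' : User H r)
    (y : ∀ h : {h : Fin H // h ∈ k.1}, DirectIdx r P b h.1 ⊕ CodedIdx r P q h.1 → Bit)
    (p : Fin P) (j : Fin b) : Bit :=
  if (k.1 ∩ k'.1).Nonempty then
    ∑ h : {h : Fin H // h ∈ k.1}, ∑ x : DirectIdx r P b h.1,
      if x.1 = ({k, k'}, p, j) then y h (Sum.inl x) else 0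
  else
    toBits b ((if IsTop (k.1 ∪ k'.1) k then (C.s : ZMod q) else -(C.s : ZMod q))⁻¹ *
      C.codewordSum q k k' y p) j

/-- The delivery phase of the interference elimination scheme with field `ZMod q`. Relays forward
all they receive. A user takes its own sub-file of the demanded file from its cache, and obtains
the sub-file stored by `k'` by removing its cached part from the message of `{k, k'}`. -/
def delivery (C : InterferenceCode H r) (N P b q : ℕ) (d : User H r → Fin N) :
    Delivery (subfilePlacement N H r P b) where
  relayIdx h := DirectIdx r P b h ⊕ CodedIdx r P q h
  linkIdx h _ := DirectIdx r P b h ⊕ CodedIdx r P q h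
  relayFintype _ := inferInstance
  linkFintype _ _ := inferInstance
  enc F h := Sum.elim
    (fun x => pairMessage d F x.1.1 x.1.2.1 x.1.2.2)
    (fun z => toBits (Nat.clog 2 q) (C.codeword q d F z.1.1 z.2.1 h z.2.2.1) z.2.2.2)
  fwd _ _ x := x
  dec k c y := fun u =>
    if u.1 = k then c ⟨(d k, (k, u.2)), by simp [subfilePlacement]⟩
    else C.recoverMessage q k u.1 y u.2.1 u.2.2 -
      c ⟨(d u.1, (k, u.2)), by simp [subfilePlacement]⟩

end InterferenceCode

/-- The load of the interference elimination scheme. -/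
noncomputable def interferenceLoad (H r : ℕ) : ℝ :=
  1 / (2 * (H : ℝ)) * ((H.choose r : ℝ) - 1 - ((H - r).choose r : ℝ)) +
    ((2 * r - 1).choose (r - 1) : ℝ) / ((2 * (r : ℝ) - 1) * (H.choose r : ℝ)) *
      ((H - 1).choose (2 * r - 1) : ℝ)

end CombinationNetwork

/-! The crux is the existence of the groups. Fix a set $A$ of $2r$ relays. A pair of users without a
common relay, with all relays in $A$, is a splitting of $A$ into two $r$-sets, and so a $\pm1$
vector on $A$ with coordinate sum $0$. These vectors live in a space of dimension $2r-1$, and there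
are $(2r-1)\,\mathrm{Cat}_{r-1}$ of them. By symmetry they form a tight frame of that space: each
has squared norm $2r$, and $\sum_J\langle u,x_J\rangle^2=2r\,\mathrm{Cat}_{r-1}\|u\|^2$ whenever $u$
is supported on $A$ and sums to $0$. Restricting the frame identity to a subspace of dimension $t$
shows that it contains at most $\mathrm{Cat}_{r-1}\,t$ of the vectors. This is Horn's condition for
splitting them into $\mathrm{Cat}_{r-1}$ independent families (`exists_partition_linearIndependent`,
deduced from Rado's theorem), and counting forces each family to have exactly $2r-1$ members. Adding
the row of ones then gives an invertible matrix (`linearIndependent_groupMatrix`), and clearing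
denominators of the solutions gives integer coefficients.

Decoding is exact: over the relays of a user, the coefficients of the other pairs in its group sum
to $0$ and those of its own pair to $\pm s$. For the load, symmetry under relabelling relays spreads
the direct messages evenly, and the coded part is counted. Bertrand's postulate provides a prime $q$
with $2^b<q\le2^{b+1}$, so a codeword costs at most $b+1$ bits, and the extra bit is negligible as
$b\to\infty$. -/

namespace CombinationNetwork

/-! ### Rado's and Horn's theorems -/

/-- Rado's theorem on independent transversals, for a monotone submodular function. -/
theorem exists_transversal_of_submodular {ι α : Type*} [Fintype ι] [DecidableEq ι] [DecidableEq α]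
    (ρ : Finset α → ℕ) (hempty : ρ ∅ = 0) (hmono : Monotone ρ)
    (hsub : ∀ X Y, ρ (X ∪ Y) + ρ (X ∩ Y) ≤ ρ X + ρ Y) (A : ι → Finset α)
    (hA : ∀ I : Finset ι, I.card ≤ ρ (I.biUnion A)) :
    ∃ f : ι → α, (∀ i, f i ∈ A i) ∧ ∀ I : Finset ι, I.card ≤ ρ (I.image f) := by
  induction hn : ∑ i, (A i).card using Nat.strong_induction_on generalizing A with
  | _ n ih =>
  subst hn
  by_cases hbig : ∃ i, 1 < (A i).card
  · obtain ⟨i, hi⟩ := hbig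
    obtain ⟨x, hx, y, hy, hxy⟩ := Finset.one_lt_card.1 hi
    -- If Rado's condition survives deleting one element of `A i`, induction on the total size
    -- finishes. It remains to see that deleting one of `x`, `y` is harmless.
    have shrink : ∀ z ∈ A i,
        (∀ I : Finset ι, I.card ≤ ρ (I.biUnion (Function.update A i ((A i).erase z)))) →
        ∃ f : ι → α, (∀ i, f i ∈ A i) ∧ ∀ I : Finset ι, I.card ≤ ρ (I.image f) := by
      intro z hz h
      have hle : ∀ j, Function.update A i ((A i).erase z) j ⊆ A j := by
        intro j
        rcases eq_or_ne j i with rfl | hj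
        · simpa using Finset.erase_subset _ _
        · simp [hj]
      obtain ⟨f, hf, hf'⟩ := ih _ (Finset.sum_lt_sum (fun j _ => Finset.card_le_card (hle j))
        ⟨i, Finset.mem_univ i, by simpa using Finset.card_erase_lt_of_mem hz⟩) _ h rfl
      exact ⟨f, fun j => hle j (hf j), hf'⟩
    by_cases h1 : ∀ I : Finset ι, I.card ≤ ρ (I.biUnion (Function.update A i ((A i).erase x)))
    · exact shrink x hx h1
    by_cases h2 : ∀ I : Finset ι, I.card ≤ ρ (I.biUnion (Function.update A i ((A i).erase y)))
    · exact shrink y hy h2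
    exfalso
    push Not at h1 h2
    obtain ⟨I, hI⟩ := h1
    obtain ⟨K, hK⟩ := h2
    -- A violating index set contains `i`, since otherwise the deletion does not affect its union.
    have mem_of : ∀ (z : α) (I : Finset ι),
        ρ (I.biUnion (Function.update A i ((A i).erase z))) < I.card → i ∈ I := by
      intro z I h
      by_contra hiI
      rw [Finset.biUnion_congr rfl (t₂ := A)] at h
      · exact absurd (hA I) (not_le.2 h)
      · intro j hj
        rw [Function.update_of_ne]
        rintro rfl
        exact hiI hj
    have hiI := mem_of x I hI
    have hiK := mem_of y K hK
    -- Nothing is lost in the union: `x` survives in the part of `K` because `x ≠ y`, and all other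
    -- elements survive in the part of `I`.
    have hunion : (I ∪ K).biUnion A ⊆
        I.biUnion (Function.update A i ((A i).erase x)) ∪
          K.biUnion (Function.update A i ((A i).erase y)) := by
      intro z hz
      obtain ⟨j, hj, hz⟩ := Finset.mem_biUnion.1 hz
      simp only [Finset.mem_union, Finset.mem_biUnion]
      rcases eq_or_ne j i with rfl | hji
      · rcases eq_or_ne z x with rfl | hzx
        · exact Or.inr ⟨j, hiK, by simp [hxy, hz]⟩
        · exact Or.inl ⟨j, hiI, by simp [hzx, hz]⟩
      · rcases Finset.mem_union.1 hj with hj | hj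
        · exact Or.inl ⟨j, hj, by simpa [hji] using hz⟩
        · exact Or.inr ⟨j, hj, by simpa [hji] using hz⟩
    -- The index `i` is dropped here because `x` and `y` may be missing from the intersection. This
    -- costs one, while the two violations together gain two: submodularity would give `|I ∪ K| + |I
    -- ∩ K| - 1 ≤ |I| + |K| - 2`.
    have hinter : ((I ∩ K).erase i).biUnion A ⊆
        I.biUnion (Function.update A i ((A i).erase x)) ∩
          K.biUnion (Function.update A i ((A i).erase y)) := by
      intro z hz
      obtain ⟨j, hj, hz⟩ := Finset.mem_biUnion.1 hz
      obtain ⟨hji, hj⟩ := Finset.mem_erase.1 hj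
      obtain ⟨hjI, hjK⟩ := Finset.mem_inter.1 hj
      simp only [Finset.mem_inter, Finset.mem_biUnion]
      exact ⟨⟨j, hjI, by simpa [hji] using hz⟩, ⟨j, hjK, by simpa [hji] using hz⟩⟩
    have e1 := hA (I ∪ K)
    have e2 := hA ((I ∩ K).erase i)
    have e3 := hmono hunion
    have e4 := hmono hinter
    have e5 := hsub (I.biUnion (Function.update A i ((A i).erase x)))
      (K.biUnion (Function.update A i ((A i).erase y)))
    have e6 := Finset.card_union_add_card_inter I K
    have e7 := Finset.card_erase_add_one (Finset.mem_inter.2 ⟨hiI, hiK⟩)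
    omega
  · push Not at hbig
    have hne : ∀ i, ∃ x, A i = {x} := by
      intro i
      refine Finset.card_eq_one.1 (le_antisymm (hbig i) (Finset.card_pos.2 ?_))
      rw [Finset.nonempty_iff_ne_empty]
      intro h
      have := hA {i}
      simp [h, hempty] at this
    choose f hf using hne
    -- For singletons the hypothesis is the conclusion.
    refine ⟨f, fun i => by simp [hf], fun I => ?_⟩
    convert hA I using 2
    ext z
    simp [hf, eq_comm]

/-- Horn's theorem: a finite family of vectors can be partitioned into `m` linearly independent
families if every subfamily has at most `m` times as many members as the dimension of
its span. -/
theorem exists_partition_linearIndependent {K V ι : Type*} [Field K] [AddCommGroup V] [Module K V]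
    [FiniteDimensional K V] [Fintype ι] (x : ι → V) (m : ℕ)
    (h : ∀ X : Finset ι, X.card ≤ m * Module.finrank K (Submodule.span K (x '' X))) :
    ∃ c : ι → Fin m, ∀ j, LinearIndependent K fun i : {i // c i = j} => x i.1 := by
  classical
  let S : Finset (ι × Fin m) → Fin m → Submodule K V :=
    fun Y j => Submodule.span K (x '' {i | (i, j) ∈ Y})
  have hS : ∀ X Y j, S (X ∪ Y) j = S X j ⊔ S Y j := by
    intro X Y j
    simp only [S]
    rw [← Submodule.span_union, ← Set.image_union]
    congr 2
    ext i
    simp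
  have hSmono : ∀ X Y j, X ⊆ Y → S X j ≤ S Y j := fun X Y j hXY =>
    Submodule.span_mono (Set.image_mono fun i hi => hXY hi)
  -- Rado's theorem on `m` disjoint copies of the vectors, with the sum of the ranks of the copies.
  -- A transversal of the sets `{i} × Fin m` picks a copy, that is a class, for each `i`.
  obtain ⟨f, hf, hcard⟩ := exists_transversal_of_submodular
    (fun Y => ∑ j, Module.finrank K (S Y j)) (by simp [S])
    (fun X Y hXY => Finset.sum_le_sum fun j _ => Submodule.finrank_mono (hSmono X Y j hXY))
    (fun X Y => by
      rw [← Finset.sum_add_distrib, ← Finset.sum_add_distrib]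
      refine Finset.sum_le_sum fun j _ => ?_
      rw [← Submodule.finrank_sup_add_finrank_inf_eq (S X j) (S Y j), hS]
      gcongr
      exact Submodule.finrank_mono (le_inf (hSmono _ _ _ Finset.inter_subset_left)
        (hSmono _ _ _ Finset.inter_subset_right)))
    (fun i : ι => Finset.univ.image fun j : Fin m => (i, j))
    (fun I => by
      have : ∀ j, S (I.biUnion fun i : ι => Finset.univ.image fun j : Fin m => (i, j)) j =
          Submodule.span K (x '' I) := by
        intro j
        change Submodule.span K _ = _
        congr 2
        ext i
        simp
      rw [Finset.sum_congr rfl fun j _ => by rw [this j]]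
      simpa using h I)
  have hf1 : ∀ i, (f i).1 = i := by
    intro i
    obtain ⟨j, -, hj⟩ := Finset.mem_image.1 (hf i)
    rw [← hj]
  refine ⟨fun i => (f i).2, fun j => ?_⟩
  have hspan : ∀ j, S (Finset.univ.image f) j =
      Submodule.span K (Set.range fun i : {i // (f i).2 = j} => x i.1) := by
    intro j
    change Submodule.span K _ = _
    congr 1
    ext v
    simp only [Finset.mem_image, Finset.mem_univ, true_and, Set.mem_image, Set.mem_ofPred_eq,
      Set.mem_range, Subtype.exists]
    constructor
    · rintro ⟨i, ⟨a, ha⟩, rfl⟩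
      have : a = i := by rw [← hf1 a, ha]
      subst this
      exact ⟨a, by rw [ha], rfl⟩
    · rintro ⟨i, hi, rfl⟩
      exact ⟨i, ⟨i, Prod.ext (hf1 i) hi⟩, rfl⟩
  have hle : ∀ j ∈ Finset.univ, Module.finrank K (S (Finset.univ.image f) j) ≤
      Fintype.card {i // (f i).2 = j} := by
    intro j _
    rw [hspan]
    exact finrank_range_le_card _
  have htot : ∑ j, Fintype.card {i // (f i).2 = j} = Fintype.card ι := by
    rw [← Fintype.card_sigma]
    exact Fintype.card_congr (Equiv.sigmaFiberEquiv fun i => (f i).2)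
  have hall := hcard Finset.univ
  rw [Finset.card_univ, ← htot] at hall
  -- The rank of a class is at most its size, and the total rank is at least the total size. So
  -- equality holds in every class, which is independence.
  have heq := (Finset.sum_eq_sum_iff_of_le hle).1 (le_antisymm (Finset.sum_le_sum hle) hall) j
    (Finset.mem_univ j)
  rw [linearIndependent_iff_card_eq_finrank_span]
  rw [hspan] at heq
  exact heq.symm

/-! ### Frame bounds and sums over `r`-subsets -/

/-- If the vectors `x i` have squared norm `a` and frame bound `b` on their span, then any of
them that lie in a space of dimension `t` number at most `b * t / a`. -/
theorem mul_card_le_mul_finrank_span {E ι : Type*} [NormedAddCommGroup E] [InnerProductSpace ℝ E]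
    [FiniteDimensional ℝ E] [Fintype ι] (x : ι → E) (a b : ℝ) (ha : ∀ i, ‖x i‖ ^ 2 = a)
    (hb : ∀ u ∈ Submodule.span ℝ (Set.range x), ∑ i, inner ℝ u (x i) ^ 2 ≤ b * ‖u‖ ^ 2)
    (X : Finset ι) : a * X.card ≤ b * Module.finrank ℝ (Submodule.span ℝ (x '' X)) := by
  set U := Submodule.span ℝ (x '' X)
  let e := stdOrthonormalBasis ℝ U
  have hnorm : ∀ i ∈ X, ∑ j, inner ℝ (e j : E) (x i) ^ 2 = a := by
    intro i hi
    have hxU : x i ∈ U := Submodule.subset_span ⟨i, hi, rfl⟩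
    have h1 := e.sum_sq_norm_inner_left ⟨x i, hxU⟩
    have h2 : ‖(⟨x i, hxU⟩ : U)‖ ^ 2 = a := ha i
    rw [h2] at h1
    rw [← h1]
    refine Finset.sum_congr rfl fun j _ => ?_
    rw [Real.norm_eq_abs, sq_abs, Submodule.coe_inner, real_inner_comm]
  -- Double counting of squared coordinates in an orthonormal basis of the span: row by row they
  -- give the norms of the vectors, column by column the frame bound at each basis vector.
  calc a * X.card = ∑ i ∈ X, ∑ j, inner ℝ (e j : E) (x i) ^ 2 := by
        rw [Finset.sum_congr rfl hnorm]; simp [mul_comm]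
    _ = ∑ j, ∑ i ∈ X, inner ℝ (e j : E) (x i) ^ 2 := Finset.sum_comm
    _ ≤ ∑ j : Fin (Module.finrank ℝ U), b := by
        refine Finset.sum_le_sum fun j _ => ?_
        have h1 := hb (e j) (Submodule.span_mono (Set.image_subset_range _ _) (e j).2)
        have h2 : ‖(e j : E)‖ = 1 := e.orthonormal.1 j
        rw [h2] at h1
        calc ∑ i ∈ X, inner ℝ (e j : E) (x i) ^ 2 ≤ ∑ i, inner ℝ (e j : E) (x i) ^ 2 :=
              Finset.sum_le_sum_of_subset_of_nonneg (Finset.subset_univ _)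
                fun _ _ _ => sq_nonneg _
          _ ≤ b := by simpa using h1
    _ = b * Module.finrank ℝ U := by simp [mul_comm]

theorem card_powersetCard_filter_mem_notMem {α : Type*} [DecidableEq α] (A : Finset α) {r : ℕ}
    (hr : 1 ≤ r) {x y : α} (hx : x ∈ A) (hy : y ∈ A) (hxy : x ≠ y) :
    ((A.powersetCard r).filter fun S => x ∈ S ∧ y ∉ S).card = (A.card - 2).choose (r - 1) := by
  have hcard : ((A.erase x).erase y).card = A.card - 2 := by
    rw [Finset.card_erase_of_mem (by simp [hxy.symm, hy]), Finset.card_erase_of_mem hx]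
    omega
  rw [← hcard, ← Finset.card_powersetCard]
  symm
  refine Finset.card_nbij (insert x) ?_ ?_ ?_
  · intro S hS
    obtain ⟨hSA, hSc⟩ := Finset.mem_powersetCard.1 (Finset.mem_coe.1 hS)
    have hxS : x ∉ S := fun h => by simpa using hSA h
    have hyS : y ∉ S := fun h => by simpa using hSA h
    simp only [Finset.coe_filter, Finset.mem_powersetCard, Set.mem_ofPred_eq,
      Finset.card_insert_of_notMem hxS]
    refine ⟨⟨Finset.insert_subset hx fun z hz => ?_, by omega⟩, by simp, by simp [hyS, hxy.symm]⟩
    exact Finset.mem_of_mem_erase (Finset.mem_of_mem_erase (hSA hz))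
  · intro S hS T hT hST
    have hxS : x ∉ S := fun h => by
      simpa using (Finset.mem_powersetCard.1 (Finset.mem_coe.1 hS)).1 h
    have hxT : x ∉ T := fun h => by
      simpa using (Finset.mem_powersetCard.1 (Finset.mem_coe.1 hT)).1 h
    rw [← Finset.erase_insert hxS, ← Finset.erase_insert hxT, hST]
  · intro S hS
    simp only [Finset.coe_filter, Finset.mem_powersetCard, Set.mem_ofPred_eq] at hS
    obtain ⟨⟨hSA, hSc⟩, hxS, hyS⟩ := hS
    refine ⟨S.erase x, ?_, Finset.insert_erase hxS⟩
    refine Finset.mem_coe.2 (Finset.mem_powersetCard.2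
      ⟨?_, by rw [Finset.card_erase_of_mem hxS, hSc]⟩)
    intro z hz
    have := Finset.mem_of_mem_erase hz
    simp only [Finset.mem_erase]
    exact ⟨fun h => hyS (h ▸ this), Finset.ne_of_mem_erase hz, hSA this⟩

/-- As `u` sums to zero, the sum over `S` is minus the sum over `A \ S`, so the square is `-∑ u i *
u j` over `i ∈ S`, `j ∉ S`. Each ordered pair `i ≠ j` is separated in this way by the same number of
sets `S`, and `∑_{j ≠ i} u j = -u i`. -/
theorem sum_powersetCard_sq_sum {α : Type*} [DecidableEq α] (A : Finset α) {r : ℕ} (hr : 1 ≤ r)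
    (u : α → ℝ) (hu : ∑ i ∈ A, u i = 0) :
    ∑ S ∈ A.powersetCard r, (∑ i ∈ S, u i) ^ 2 =
      (A.card - 2).choose (r - 1) * ∑ i ∈ A, u i ^ 2 := by
  have h1 : ∀ S ∈ A.powersetCard r, (∑ i ∈ S, u i) ^ 2 =
      -∑ i ∈ A, ∑ j ∈ A, if i ∈ S ∧ j ∉ S then u i * u j else 0 := by
    intro S hS
    have hSA := (Finset.mem_powersetCard.1 hS).1
    have h2 : ∑ i ∈ S, u i = -∑ j ∈ A \ S, u j := by
      rw [← Finset.sum_sdiff hSA] at hu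
      linarith
    have h3 : ∑ i ∈ A, ∑ j ∈ A, (if i ∈ S ∧ j ∉ S then u i * u j else 0) =
        (∑ i ∈ S, u i) * ∑ j ∈ A \ S, u j := by
      rw [Finset.sum_mul_sum, ← Finset.inter_eq_right.2 hSA, ← Finset.sum_ite_mem]
      refine Finset.sum_congr rfl fun i _ => ?_
      rw [Finset.inter_eq_right.2 hSA]
      by_cases hi : i ∈ S
      · simp only [hi, true_and, if_true]
        rw [Finset.sdiff_eq_filter, Finset.sum_filter]
      · simp [hi]
    rw [h3, sq]
    nth_rw 2 [h2]
    ring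
  rw [Finset.sum_congr rfl h1, Finset.sum_neg_distrib, Finset.sum_comm]
  have h4 : ∀ i ∈ A, ∑ S ∈ A.powersetCard r, ∑ j ∈ A, (if i ∈ S ∧ j ∉ S then u i * u j else 0) =
      -((A.card - 2).choose (r - 1) * u i ^ 2) := by
    intro i hi
    rw [Finset.sum_comm]
    -- The correction at `j = i` makes the right-hand side vanish there: no `S` both contains and
    -- misses `i`.
    have h5 : ∀ j ∈ A, ∑ S ∈ A.powersetCard r, (if i ∈ S ∧ j ∉ S then u i * u j else 0) =
        (A.card - 2).choose (r - 1) * u i * (u j - if j = i then u i else 0) := by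
      intro j hj
      rw [← Finset.sum_filter, Finset.sum_const]
      rcases eq_or_ne j i with rfl | hij
      · simp
      · rw [card_powersetCard_filter_mem_notMem A hr hi hj hij.symm]
        simp [hij, mul_assoc]
    rw [Finset.sum_congr rfl h5, ← Finset.mul_sum, Finset.sum_sub_distrib, hu]
    simp [hi]
    ring
  rw [Finset.sum_congr rfl h4, Finset.sum_neg_distrib, neg_neg, Finset.mul_sum]

/-! ### The number of groups is a Catalan number -/

theorem choose_eq_mul_catalan (n : ℕ) : (2 * n + 1).choose n = (2 * n + 1) * catalan n := by
  have h1 := Nat.add_one_mul_choose_eq (2 * n) n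
  have h2 : (2 * n + 1).choose (n + 1) = (2 * n + 1).choose n :=
    Nat.choose_symm_of_eq_add (by omega)
  have h3 : (2 * n).choose n = (n + 1) * catalan n := by
    rw [succ_mul_catalan_eq_centralBinom, Nat.centralBinom]
  apply Nat.eq_of_mul_eq_mul_left (Nat.succ_pos n)
  rw [h2, h3] at h1
  rw [Nat.succ_eq_add_one]
  linarith

theorem groupCount_eq_catalan (n : ℕ) : groupCount (n + 1) = catalan n := by
  rw [groupCount, show 2 * (n + 1) - 1 = 2 * n + 1 by omega, Nat.add_sub_cancel,
    choose_eq_mul_catalan]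
  exact Nat.mul_div_cancel_left _ (by omega)

theorem choose_eq_mul_groupCount {r : ℕ} (hr : 1 ≤ r) :
    (2 * r - 2).choose (r - 1) = r * groupCount r := by
  obtain ⟨n, rfl⟩ := Nat.exists_eq_add_of_le' hr
  rw [groupCount_eq_catalan, succ_mul_catalan_eq_centralBinom, Nat.centralBinom]
  congr 1

theorem choose_eq_two_mul_sub_one_mul_groupCount {r : ℕ} (hr : 1 ≤ r) :
    (2 * r - 1).choose (r - 1) = (2 * r - 1) * groupCount r := by
  obtain ⟨n, rfl⟩ := Nat.exists_eq_add_of_le' hr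
  rw [groupCount_eq_catalan, show 2 * (n + 1) - 1 = 2 * n + 1 by omega, Nat.add_sub_cancel,
    choose_eq_mul_catalan]

/-! ## Pairs of users without a common relay -/

section Pairs

variable {H r : ℕ} {A : Finset (Fin H)} {J : Finset (User H r)}

theorem exists_eq_pair_of_mem_separatedPairsIn (hA : A.card = 2 * r)
    (hJ : J ∈ separatedPairsIn r A) {k : User H r} (hk : k ∈ J) :
    ∃ k', k ≠ k' ∧ J = {k, k'} ∧ k.1 ⊆ A ∧ k'.1 = A \ k.1 := by
  simp only [separatedPairsIn, separatedPairs, Finset.mem_filter, Finset.mem_univ, true_and] at hJ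
  obtain ⟨⟨hc, hcom⟩, hsub⟩ := hJ
  obtain ⟨k', hk'⟩ := Finset.card_eq_one.1
    (by rw [Finset.card_erase_of_mem hk, hc] : (J.erase k).card = 1)
  have hk'J : k' ∈ J.erase k := by simp [hk']
  have hJ' : J = {k, k'} := by rw [← Finset.insert_erase hk, hk']
  refine ⟨k', (Finset.ne_of_mem_erase hk'J).symm, hJ', hsub k hk, ?_⟩
  apply Finset.eq_of_subset_of_card_le
  · intro h hh
    refine Finset.mem_sdiff.2 ⟨hsub k' (Finset.mem_of_mem_erase hk'J) hh, fun hh' => ?_⟩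
    have : h ∈ commonRelays J := by simp [commonRelays, hJ', hh, hh']
    simp [hcom] at this
  · rw [Finset.card_sdiff_of_subset (hsub k hk), hA, k.2, k'.2]
    omega

theorem pair_mem_separatedPairsIn (hr : 1 ≤ r) {k k' : User H r} (hk : k.1 ⊆ A)
    (hk' : k'.1 = A \ k.1) : ({k, k'} : Finset (User H r)) ∈ separatedPairsIn r A := by
  have hne : k ≠ k' := by
    rintro rfl
    obtain ⟨h, hh⟩ := Finset.card_pos.1 (by rw [k.2]; omega : 0 < k.1.card)
    have hh' := hh
    rw [hk'] at hh'
    exact (Finset.mem_sdiff.1 hh').2 hh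
  simp only [separatedPairsIn, separatedPairs, Finset.mem_filter, Finset.mem_univ, true_and]
  refine ⟨⟨Finset.card_pair hne, ?_⟩, ?_⟩
  · ext h
    simp only [commonRelays, Finset.mem_filter, Finset.mem_univ, true_and, Finset.mem_insert,
      Finset.mem_singleton, forall_eq_or_imp, forall_eq, hk', Finset.mem_sdiff]
    simp
    tauto
  · simp [hk, hk']

/-- The other user of a pair is determined as the complement in `A`, so choosing a pair and one of
its users amounts to choosing an `r`-subset of `A`. -/
theorem sum_separatedPairsIn {M : Type*} [AddCommMonoid M] (hr : 1 ≤ r) (hA : A.card = 2 * r)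
    (g : Finset (Fin H) → M) :
    ∑ J ∈ separatedPairsIn r A, ∑ k ∈ J, g k.1 = ∑ S ∈ A.powersetCard r, g S := by
  rw [Finset.sum_sigma']
  refine Finset.sum_nbij (fun x => x.2.1) ?_ ?_ ?_ (fun _ _ => rfl)
  · rintro ⟨J, k⟩ h
    obtain ⟨hJ, hk⟩ := Finset.mem_sigma.1 h
    obtain ⟨k', -, -, hkA, -⟩ := exists_eq_pair_of_mem_separatedPairsIn hA hJ hk
    exact Finset.mem_powersetCard.2 ⟨hkA, k.2⟩
  · rintro ⟨J, k⟩ h ⟨J', k₂⟩ h' heq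
    obtain ⟨hJ, hk⟩ := Finset.mem_sigma.1 (Finset.mem_coe.1 h)
    obtain ⟨hJ', hk'⟩ := Finset.mem_sigma.1 (Finset.mem_coe.1 h')
    obtain rfl : k = k₂ := Subtype.ext heq
    obtain ⟨k₁, -, h1, -, h1'⟩ := exists_eq_pair_of_mem_separatedPairsIn hA hJ hk
    obtain ⟨k₂, -, h2, -, h2'⟩ := exists_eq_pair_of_mem_separatedPairsIn hA hJ' hk'
    obtain rfl : k₁ = k₂ := Subtype.ext (h1'.trans h2'.symm)
    simp only at h1 h2
    rw [h1, h2]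
  · intro S hS
    obtain ⟨hSA, hSc⟩ := Finset.mem_powersetCard.1 (Finset.mem_coe.1 hS)
    have hc : (A \ S).card = r := by rw [Finset.card_sdiff_of_subset hSA]; omega
    exact ⟨⟨{⟨S, hSc⟩, ⟨A \ S, hc⟩}, ⟨S, hSc⟩⟩,
      by simpa using pair_mem_separatedPairsIn hr hSA rfl, rfl⟩

theorem card_separatedPairsIn (hr : 1 ≤ r) (hA : A.card = 2 * r) :
    (separatedPairsIn r A).card = (2 * r - 1) * groupCount r := by
  have h1 := sum_separatedPairsIn hr hA fun _ => 1
  have h2 : ∀ J ∈ separatedPairsIn r A, ∑ k ∈ J, 1 = 2 := by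
    intro J hJ
    simp only [separatedPairsIn, separatedPairs, Finset.mem_filter] at hJ
    simp [hJ.1.2.1]
  rw [Finset.sum_congr rfl h2, Finset.sum_const, Finset.sum_const, Finset.card_powersetCard,
    hA] at h1
  rw [← choose_eq_two_mul_sub_one_mul_groupCount hr]
  obtain ⟨n, rfl⟩ := Nat.exists_eq_add_of_le' hr
  have h3 : (2 * n + 1).choose (n + 1) = (2 * n + 1).choose n :=
    Nat.choose_symm_of_eq_add (by omega)
  rw [show 2 * (n + 1) = (2 * n + 1) + 1 by ring, Nat.choose_succ_succ, h3] at h1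
  rw [show 2 * (n + 1) - 1 = 2 * n + 1 by omega, Nat.add_sub_cancel]
  simp only [smul_eq_mul] at h1
  omega

theorem isTop_compl_iff (hr : 1 ≤ r) (hA : A.card = 2 * r) {k k' : User H r} (hk : k.1 ⊆ A)
    (hk' : k'.1 = A \ k.1) : IsTop A k' ↔ ¬ IsTop A k := by
  obtain ⟨l, hlA, hl⟩ := A.exists_max_image id (Finset.card_pos.1 (by omega))
  have key : ∀ j : User H r, j.1 ⊆ A → (IsTop A j ↔ l ∈ j.1) := by
    intro j hj
    constructor
    · rintro ⟨m, hm, hm'⟩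
      rwa [le_antisymm (hm' l hlA) (hl m (hj hm))]
    · exact fun h => ⟨l, h, hl⟩
  rw [key k hk, key k' (by rw [hk']; exact Finset.sdiff_subset), hk', Finset.mem_sdiff]
  tauto

/-- A pair of users without a common relay consists of a user that is connected to the last relay
of `A` and one that is connected to the other relays. -/
theorem exists_isTop_pair (hr : 1 ≤ r) (hA : A.card = 2 * r) (hJ : J ∈ separatedPairsIn r A) :
    ∃ k k', k ≠ k' ∧ J = {k, k'} ∧ k.1 ⊆ A ∧ k'.1 = A \ k.1 ∧ IsTop A k ∧ ¬ IsTop A k' := by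
  have hc : J.card = 2 := by
    simp only [separatedPairsIn, separatedPairs, Finset.mem_filter] at hJ
    exact hJ.1.2.1
  obtain ⟨k, hk⟩ := Finset.card_pos.1 (by omega : 0 < J.card)
  obtain ⟨k', hne, hJ', hkA, hk'⟩ := exists_eq_pair_of_mem_separatedPairsIn hA hJ hk
  have htop := isTop_compl_iff hr hA hkA hk'
  by_cases h : IsTop A k
  · exact ⟨k, k', hne, hJ', hkA, hk', h, by tauto⟩
  · refine ⟨k', k, hne.symm, hJ'.trans (Finset.pair_comm _ _), ?_, ?_, by tauto, h⟩
    · rw [hk']; exact Finset.sdiff_subset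
    · rw [hk', Finset.sdiff_sdiff_eq_self hkA]

theorem exists_isTop_mem_iff {k k' : User H r} (hJ : J = {k, k'}) (hk : IsTop A k)
    (hk' : ¬ IsTop A k') (h : Fin H) : (∃ j ∈ J, IsTop A j ∧ h ∈ j.1) ↔ h ∈ k.1 := by
  simp [hJ, hk, hk']

end Pairs

/-! ### Division of the pairs into groups of full rank -/

section Partition

variable {H r : ℕ} {A : Finset (Fin H)} {J : Finset (User H r)}

/-- The difference of the indicators of the relays of the two users in `J` (for a pair `J` in
`separatedPairsIn r A`). -/
noncomputable def pairVector (A : Finset (Fin H)) (J : Finset (User H r)) :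
    EuclideanSpace ℝ (Fin H) :=
  WithLp.toLp 2 fun h =>
    if h ∈ A then 2 * (if ∃ k ∈ J, IsTop A k ∧ h ∈ k.1 then 1 else 0) - 1 else 0

theorem norm_pairVector_sq (A : Finset (Fin H)) (J : Finset (User H r)) :
    ‖pairVector A J‖ ^ 2 = A.card := by
  rw [EuclideanSpace.real_norm_sq_eq]
  have : ∀ h, (pairVector A J) h ^ 2 = if h ∈ A then 1 else 0 := by
    intro h
    simp only [pairVector]
    split_ifs <;> norm_num
  simp [this]

theorem inner_pairVector (u : EuclideanSpace ℝ (Fin H)) (hu : ∑ h ∈ A, u h = 0)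
    {k k' : User H r} (hJ : J = {k, k'}) (hkA : k.1 ⊆ A) (hk : IsTop A k) (hk' : ¬ IsTop A k') :
    inner ℝ u (pairVector A J) = 2 * ∑ h ∈ k.1, u h := by
  have : ∀ h, inner ℝ (u h) ((pairVector A J) h) =
      if h ∈ A then 2 * (if h ∈ k.1 then u h else 0) - u h else 0 := by
    intro h
    simp only [pairVector, exists_isTop_mem_iff hJ hk hk']
    (split_ifs <;> simp); ring
  rw [PiLp.inner_apply, Finset.sum_congr rfl fun h _ => this h, Finset.sum_ite_mem,
    Finset.univ_inter, Finset.sum_sub_distrib, hu, sub_zero, ← Finset.mul_sum,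
    Finset.sum_ite_mem, Finset.inter_eq_right.2 hkA]

theorem sum_pairVector (hr : 1 ≤ r) (hA : A.card = 2 * r) (hJ : J ∈ separatedPairsIn r A) :
    ∑ h ∈ A, (pairVector A J) h = 0 := by
  obtain ⟨k, k', -, hJ', hkA, -, hk, hk'⟩ := exists_isTop_pair hr hA hJ
  have : ∀ h ∈ A, (pairVector A J) h = 2 * (if h ∈ k.1 then 1 else 0) - 1 := by
    intro h hh
    simp only [pairVector, exists_isTop_mem_iff hJ' hk hk', hh, if_true]
  rw [Finset.sum_congr rfl this, Finset.sum_sub_distrib, ← Finset.mul_sum, Finset.sum_ite_mem,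
    Finset.inter_eq_right.2 hkA]
  simp [k.2, hA]

/-- The frame bound. The two users of a pair have opposite sums of `u`, so the squared inner product
is spread evenly over both, which turns the sum over pairs into one over all `r`-subsets of `A`.
Only `≤` remains because `u` may have coordinates outside `A`. -/
theorem sum_inner_pairVector_sq_le (hr : 1 ≤ r) (hA : A.card = 2 * r)
    (u : EuclideanSpace ℝ (Fin H)) (hu : ∑ h ∈ A, u h = 0) :
    ∑ J ∈ separatedPairsIn r A, inner ℝ u (pairVector A J) ^ 2 ≤
      2 * (r * groupCount r) * ‖u‖ ^ 2 := by
  have h1 : ∀ J ∈ separatedPairsIn r A, inner ℝ u (pairVector A J) ^ 2 =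
      2 * ∑ k ∈ J, (∑ h ∈ k.1, u h) ^ 2 := by
    intro J hJ
    obtain ⟨k, k', hne, hJ', hkA, hkk', hk, hk'⟩ := exists_isTop_pair hr hA hJ
    rw [inner_pairVector u hu hJ' hkA hk hk', hJ', Finset.sum_pair hne, hkk']
    have : ∑ h ∈ A \ k.1, u h = -∑ h ∈ k.1, u h := by
      rw [← Finset.sum_sdiff hkA] at hu
      linarith
    rw [this]
    ring
  rw [Finset.sum_congr rfl h1, ← Finset.mul_sum,
    sum_separatedPairsIn hr hA fun S => (∑ h ∈ S, u h) ^ 2, sum_powersetCard_sq_sum A hr _ hu, hA,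
    choose_eq_mul_groupCount hr, EuclideanSpace.real_norm_sq_eq, mul_assoc]
  push_cast
  gcongr
  exact Finset.subset_univ _

/-- Horn's condition: the quotient of the frame bound `2 * (r * groupCount r)` by the squared norm
`2 * r` is exactly the number of groups. -/
theorem card_le_mul_finrank_span_pairVector (hr : 1 ≤ r) (hA : A.card = 2 * r)
    (X : Finset {J // J ∈ separatedPairsIn r A}) :
    X.card ≤ groupCount r *
      Module.finrank ℝ (Submodule.span ℝ ((fun J : {J // J ∈ separatedPairsIn r A} => pairVector A J.1) '' X)) := by
  have h := mul_card_le_mul_finrank_span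
    (fun J : {J // J ∈ separatedPairsIn r A} => pairVector A J.1) (2 * r : ℝ)
    (2 * (r * groupCount r)) (fun J => by rw [norm_pairVector_sq, hA]; push_cast; ring) ?_ X
  · have hr' : (0 : ℝ) < 2 * r := by positivity
    have : (X.card : ℝ) ≤ groupCount r *
        Module.finrank ℝ (Submodule.span ℝ ((fun J : {J // J ∈ separatedPairsIn r A} => pairVector A J.1) '' X)) :=
      le_of_mul_le_mul_left (h.trans_eq (by ring)) hr'
    exact_mod_cast this
  · intro u hu
    have hu0 : ∑ h ∈ A, u h = 0 := by
      induction hu using Submodule.span_induction with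
      | mem x hx =>
        obtain ⟨J, rfl⟩ := hx
        exact sum_pairVector hr hA J.2
      | zero => simp
      | add x y _ _ hx hy => simp [Finset.sum_add_distrib, hx, hy]
      | smul a x _ hx => simp [← Finset.mul_sum, hx]
    rw [Finset.sum_coe_sort (separatedPairsIn r A) fun J => inner ℝ u (pairVector A J) ^ 2]
    exact sum_inner_pairVector_sq_le hr hA u hu0

/-- Summing a relation between the rows over all columns gives `2 * c none + ∑ c J = 0`, because the
row of ones sums to `2 * r` and every other row to `r`. This eliminates `c none` and leaves a
relation between the `±1` vectors `2 * row - 1`, which are the `pairVector`s. -/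
theorem linearIndependent_groupMatrix (hr : 1 ≤ r) (hA : A.card = 2 * r)
    {G : Finset (Finset (User H r))} (hG : G ⊆ separatedPairsIn r A)
    (hli : LinearIndependent ℝ fun J : G => pairVector A J.1) :
    LinearIndependent ℚ (groupMatrix A G).row := by
  rw [Fintype.linearIndependent_iff]
  intro c hc
  have hrow : ∀ h : A, c none + ∑ J : G, c (some J) * groupMatrix A G (some J) h = 0 := by
    intro h
    have := congrFun hc h
    simpa [Fintype.sum_option, Matrix.row, groupMatrix] using this
  have hsum : ∀ J : G, ∑ h : A, groupMatrix A G (some J) h = r := by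
    intro J
    obtain ⟨k, k', -, hJ', hkA, -, hk, hk'⟩ := exists_isTop_pair hr hA (hG J.2)
    simp only [groupMatrix, exists_isTop_mem_iff hJ' hk hk']
    rw [Finset.sum_coe_sort A fun h => if h ∈ k.1 then (1 : ℚ) else 0, Finset.sum_ite_mem,
      Finset.inter_eq_right.2 hkA]
    simp [k.2]
  have h0 : 2 * c none + ∑ J : G, c (some J) = 0 := by
    have h1 : ∑ h : A, (c none + ∑ J : G, c (some J) * groupMatrix A G (some J) h) = 0 :=
      Finset.sum_eq_zero fun h _ => hrow h
    rw [Finset.sum_add_distrib, Finset.sum_comm] at h1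
    simp only [← Finset.mul_sum, hsum, ← Finset.sum_mul] at h1
    simp only [Finset.sum_const, Finset.card_univ, Fintype.card_coe, hA, nsmul_eq_mul] at h1
    push_cast at h1
    have hr' : (r : ℚ) ≠ 0 := by positivity
    apply mul_left_cancel₀ hr'
    linarith
  have hcJ : ∀ J : G, c (some J) = 0 := by
    intro J
    have := Fintype.linearIndependent_iff.1 hli (fun J => (c (some J) : ℝ)) (by
      ext h
      by_cases hh : h ∈ A
      · have h2 : ∑ J : G, c (some J) * (2 * groupMatrix A G (some J) ⟨h, hh⟩ - 1) = 0 := by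
          have h3 := hrow ⟨h, hh⟩
          simp only [mul_sub, mul_one, Finset.sum_sub_distrib]
          simp only [mul_left_comm _ (2 : ℚ), ← Finset.mul_sum]
          linarith
        have h4 : ((∑ J : G, c (some J) * (2 * groupMatrix A G (some J) ⟨h, hh⟩ - 1) : ℚ) : ℝ)
            = 0 := by rw [h2]; simp
        have h5 : ∀ J : G, ((groupMatrix A G (some J) ⟨h, hh⟩ : ℚ) : ℝ) =
            if ∃ k ∈ J.1, IsTop A k ∧ h ∈ k.1 then 1 else 0 := by
          intro J
          simp only [groupMatrix]
          split_ifs <;> simp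
        push_cast at h4
        simp only [h5] at h4
        rw [PiLp.zero_apply, ← h4, WithLp.ofLp_sum, Finset.sum_apply]
        refine Finset.sum_congr rfl fun J _ => ?_
        simp only [pairVector, hh, if_true, PiLp.smul_apply, smul_eq_mul]
      · simp [pairVector, hh]) J
    exact_mod_cast this
  rintro (_ | J)
  · simp only [hcJ, Finset.sum_const_zero, add_zero] at h0
    linarith
  · exact hcJ J

/-- The pairs of users without a common relay and with all relays in `A` can be divided into
groups whose matrices have full rank. -/
theorem exists_groups (hr : 1 ≤ r) (hA : A.card = 2 * r) :
    ∃ group : Fin (groupCount r) → Finset (Finset (User H r)),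
      (∀ g, (group g).card = 2 * r - 1) ∧ (∀ g, group g ⊆ separatedPairsIn r A) ∧
      (∀ J ∈ separatedPairsIn r A, ∃! g, J ∈ group g) ∧
      ∀ g, (groupMatrix A (group g)).rank = 2 * r := by
  obtain ⟨c, hc⟩ := exists_partition_linearIndependent
    (fun J : {J // J ∈ separatedPairsIn r A} => pairVector A J.1) (groupCount r)
    (card_le_mul_finrank_span_pairVector hr hA)
  let group : Fin (groupCount r) → Finset (Finset (User H r)) := fun g =>
    (Finset.univ.filter fun J => c J = g).map (Function.Embedding.subtype _)
  have hmem : ∀ g J, J ∈ group g ↔ ∃ hJ : J ∈ separatedPairsIn r A, c ⟨J, hJ⟩ = g := by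
    intro g J
    simp [group]
  have hsub : ∀ g, group g ⊆ separatedPairsIn r A := fun g J hJ => ((hmem g J).1 hJ).1
  have hli : ∀ g, LinearIndependent ℚ (groupMatrix A (group g)).row := by
    intro g
    refine linearIndependent_groupMatrix hr hA (hsub g) ?_
    let e : group g → {J // c J = g} := fun J =>
      ⟨⟨J.1, ((hmem g J.1).1 J.2).1⟩, ((hmem g J.1).1 J.2).2⟩
    have he : Function.Injective e := fun J J' h =>
      Subtype.ext (congrArg (fun z => z.1.1) h)
    exact (hc g).comp e he
  -- With the row of ones, a group gives independent rows in dimension `2 * r`. The total number of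
  -- pairs leaves no room for a smaller group.
  have hle : ∀ g ∈ Finset.univ, (group g).card ≤ 2 * r - 1 := by
    intro g _
    have := (hli g).fintype_card_le_finrank
    simp only [Fintype.card_option, Fintype.card_coe, Module.finrank_fintype_fun_eq_card, hA]
      at this
    omega
  have htot : ∑ g, (group g).card = ∑ g : Fin (groupCount r), (2 * r - 1) := by
    have h1 := Finset.card_eq_sum_card_fiberwise (s := Finset.univ) (t := Finset.univ) (f := c)
      (by simp)
    rw [Finset.card_univ, Fintype.card_coe, card_separatedPairsIn hr hA] at h1
    simp only [group, Finset.card_map]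
    rw [← h1]
    simp [mul_comm]
  have hcard : ∀ g, (group g).card = 2 * r - 1 := fun g =>
    (Finset.sum_eq_sum_iff_of_le hle).1 htot g (Finset.mem_univ g)
  refine ⟨group, hcard, hsub, fun J hJ => ⟨c ⟨J, hJ⟩, (hmem _ _).2 ⟨hJ, rfl⟩, fun g hg => ?_⟩,
    fun g => ?_⟩
  · exact ((hmem g J).1 hg).2.symm
  · rw [(hli g).rank_matrix, Fintype.card_option, Fintype.card_coe, hcard]
    omega

/-- A matrix whose rank is the number of rows defines a surjective map. -/
theorem exists_mulVec_eq {m n : Type*} [Fintype m] [Fintype n] {K : Type*} [Field K]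
    (M : Matrix m n K) (hM : M.rank = Fintype.card m) (y : m → K) : ∃ x, M.mulVec x = y := by
  have : LinearMap.range M.mulVecLin = ⊤ :=
    Submodule.eq_top_of_finrank_eq (by rw [← Matrix.rank, hM, Module.finrank_fintype_fun_eq_card])
  exact LinearMap.range_eq_top.1 this y

/-- The data of the interference elimination scheme exist. -/
theorem nonempty_interferenceCode (H : ℕ) {r : ℕ} (hr : 1 ≤ r) :
    Nonempty (InterferenceCode H r) := by
  have hex : ∀ A : Finset (Fin H), ∃ group : Fin (groupCount r) → Finset (Finset (User H r)),
      A.card = 2 * r →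
      (∀ g, (group g).card = 2 * r - 1) ∧ (∀ g, group g ⊆ separatedPairsIn r A) ∧
      (∀ J ∈ separatedPairsIn r A, ∃! g, J ∈ group g) ∧
      ∀ g, (groupMatrix A (group g)).rank = 2 * r := by
    intro A
    by_cases hA : A.card = 2 * r
    · obtain ⟨group, h⟩ := exists_groups hr hA
      exact ⟨group, fun _ => h⟩
    · exact ⟨fun _ => ∅, fun h => absurd h hA⟩
  choose group hgroup using hex
  have hsol : ∀ (A : Finset (Fin H)) (J : Finset (User H r)), ∃ x : Fin H → ℚ, A.card = 2 * r →
      ∀ g, ∀ hJ : J ∈ group A g, (groupMatrix A (group A g)).mulVec (fun i => x i.1) =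
        Pi.single (some ⟨J, hJ⟩) 1 := by
    intro A J
    by_cases h : A.card = 2 * r ∧ ∃ g, J ∈ group A g
    · obtain ⟨hA, g, hJ⟩ := h
      obtain ⟨hcard, hsub, hcover, hrank⟩ := hgroup A hA
      obtain ⟨x, hx⟩ := exists_mulVec_eq (groupMatrix A (group A g))
        (by rw [hrank, Fintype.card_option, Fintype.card_coe, hcard]; omega)
        (Pi.single (some ⟨J, hJ⟩) 1)
      refine ⟨fun i => if hi : i ∈ A then x ⟨i, hi⟩ else 0, fun _ g' hJ' => ?_⟩
      obtain rfl : g' = g := (hcover J (hsub g hJ)).unique hJ' hJ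
      rw [← hx]
      congr 1
      ext i
      simp
    · exact ⟨0, fun hA g hJ => absurd ⟨hA, g, hJ⟩ h⟩
  choose x hx using hsol
  -- One common denominator for the rational solutions of all groups serves as `s`.
  obtain ⟨s, hs⟩ := IsLocalization.exist_integer_multiples_of_finite (nonZeroDivisors ℤ)
    fun z : Finset (Fin H) × Finset (User H r) × Fin H => x z.1 z.2.1 z.2.2
  choose a ha using hs
  exact ⟨{
    group := group
    group_card := fun A hA => (hgroup A hA).1
    group_subset := fun A hA => (hgroup A hA).2.1
    group_cover := fun A hA => (hgroup A hA).2.2.1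
    full_rank := fun A hA => (hgroup A hA).2.2.2
    s := s
    s_ne_zero := nonZeroDivisors.coe_ne_zero s
    coef := fun A J h => a (A, J, h)
    coef_spec := fun A hA g J => by
      have h1 : (fun i : A => ((a (A, J.1, i.1) : ℤ) : ℚ)) =
          ((s : ℤ) : ℚ) • fun i : A => x A J.1 i.1 := by
        ext i
        simpa using ha (A, J.1, i.1)
      rw [h1, Matrix.mulVec_smul, hx A J.1 hA g J.2]
      ext o
      simp [Pi.single_apply] }⟩

end Partition

/-! ## Bit strings and field elements -/

theorem ofBits_eq_sum {n : ℕ} (f : Fin n → Bool) :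
    Nat.ofBits f = ∑ j : Fin n, (f j).toNat * 2 ^ (j : ℕ) := by
  induction n with
  | zero => simp
  | succ n ih =>
    rw [Nat.ofBits_succ, ih, Fin.sum_univ_succ, Finset.mul_sum, add_comm]
    simp [pow_succ, mul_comm, mul_left_comm]

theorem toField_eq_natCast_ofBits (q : ℕ) {n : ℕ} (x : Fin n → Bit) :
    toField q x = (Nat.ofBits fun j => decide (x j = 1) : ZMod q) := by
  have h : ∀ y : Bit, y.val = (decide (y = 1)).toNat := by decide
  simp [toField, ofBits_eq_sum, h]

theorem toBits_toField {q b : ℕ} (hq : 2 ^ b ≤ q) (x : Fin b → Bit) :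
    toBits b (toField q x) = x := by
  ext t
  have h : ∀ y : Bit, (if decide (y = 1) = true then (1 : Bit) else 0) = y := by decide
  rw [toBits, toField_eq_natCast_ofBits, ZMod.val_cast_of_lt ((Nat.ofBits_lt_two_pow _).trans_le hq),
    Nat.testBit_ofBits_lt _ _ t.2]
  exact h (x t)

theorem toField_toBits {q n : ℕ} [NeZero q] (hq : q ≤ 2 ^ n) (y : ZMod q) :
    toField q (toBits n y) = y := by
  have h : (fun j : Fin n => decide (toBits n y j = 1)) =
      fun j : Fin n => y.val.testBit j := by
    ext j
    by_cases h : y.val.testBit j <;> simp [toBits, h]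
  rw [toField_eq_natCast_ofBits, h, Nat.ofBits_testBit, Nat.mod_eq_of_lt ((ZMod.val_lt y).trans_le hq),
    ZMod.natCast_zmod_val]

/-! ## Decoding -/

/-- The number of smaller elements is strictly increasing on `S`, hence a bijection onto `0, …, |S|
- 1`. For common relays it shows that each packet of a direct message travels through exactly one of
them. -/
theorem existsUnique_card_filter_lt_eq {α : Type*} [LinearOrder α] (S : Finset α) {i : ℕ}
    (hi : i < S.card) : ∃! x, x ∈ S ∧ (S.filter fun y => y < x).card = i := by
  have hinj : Set.InjOn (fun x => (S.filter fun y => y < x).card) S := by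
    have hlt : ∀ x ∈ S, ∀ x', x < x' →
        (S.filter fun y => y < x).card < (S.filter fun y => y < x').card := by
      intro x hx x' hxx'
      apply Finset.card_lt_card
      refine ⟨fun y hy => ?_, fun h => ?_⟩
      · simp only [Finset.mem_filter] at hy ⊢
        exact ⟨hy.1, hy.2.trans hxx'⟩
      · simpa using h (Finset.mem_filter.2 ⟨hx, hxx'⟩)
    intro x hx x' hx' h
    rcases lt_trichotomy x x' with h' | h' | h'
    · exact absurd h (hlt x hx x' h').ne
    · exact h'
    · exact absurd h.symm (hlt x' hx' x h').ne
  have himage : S.image (fun x => (S.filter fun y => y < x).card) = Finset.range S.card := by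
    apply Finset.eq_of_subset_of_card_le
    · intro n hn
      obtain ⟨x, hx, rfl⟩ := Finset.mem_image.1 hn
      refine Finset.mem_range.2 (Finset.card_lt_card ⟨Finset.filter_subset _ _, fun h => ?_⟩)
      simpa using h hx
    · rw [Finset.card_image_of_injOn hinj, Finset.card_range]
  obtain ⟨x, hx, hxi⟩ := Finset.mem_image.1 (himage ▸ Finset.mem_range.2 hi)
  exact ⟨x, ⟨hx, hxi⟩, fun x' h => hinj h.1 hx (h.2.trans hxi.symm)⟩

section Decoding

variable {N H r P b : ℕ}

theorem pairMessage_pair (d : User H r → Fin N) (F : Library N (PacketIdx H r P b))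
    {k k' : User H r} (hne : k ≠ k') (p : Fin P) (j : Fin b) :
    pairMessage d F {k, k'} p j = F (d k) (k', p, j) + F (d k') (k, p, j) := by
  have h1 : ({k, k'} : Finset (User H r)).erase k = {k'} :=
    Finset.erase_insert (by simpa using hne)
  have h2 : ({k, k'} : Finset (User H r)).erase k' = {k} := by
    rw [Finset.pair_comm]
    exact Finset.erase_insert (by simpa using hne.symm)
  rw [pairMessage, Finset.sum_pair hne, h1, h2, Finset.sum_singleton, Finset.sum_singleton]

theorem commonRelays_pair (k k' : User H r) : commonRelays {k, k'} = k.1 ∩ k'.1 := by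
  ext h
  simp [commonRelays]

namespace InterferenceCode

variable (C : InterferenceCode H r)

theorem sum_coef {A : Finset (Fin H)} (hA : A.card = 2 * r) {g : Fin (groupCount r)}
    {J : Finset (User H r)} (hJ : J ∈ C.group A g) : ∑ h ∈ A, C.coef A J h = 0 := by
  have h1 := congrFun (C.coef_spec A hA g ⟨J, hJ⟩) none
  simp only [Matrix.mulVec, dotProduct, groupMatrix, one_mul] at h1
  rw [Finset.sum_coe_sort A fun h => (C.coef A J h : ℚ)] at h1
  simp only [Pi.single_apply, reduceCtorEq, if_false] at h1
  exact_mod_cast h1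

/-- A user of a pair eliminates the messages of the other pairs in the group by summing the
codewords. -/
theorem sum_coef_user {A : Finset (Fin H)} (hr : 1 ≤ r) (hA : A.card = 2 * r)
    {g : Fin (groupCount r)} {k k' : User H r} (hkA : k.1 ⊆ A) (hk' : k'.1 = A \ k.1)
    (hkk' : {k, k'} ∈ C.group A g) {J : Finset (User H r)} (hJ : J ∈ C.group A g) :
    ∑ h ∈ k.1, C.coef A J h =
      if J = {k, k'} then (if IsTop A k then C.s else -C.s) else 0 := by
  have htop : ∀ k k' : User H r, k.1 ⊆ A → IsTop A k → ¬ IsTop A k' → {k, k'} ∈ C.group A g →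
      ∑ h ∈ k.1, C.coef A J h = if J = {k, k'} then C.s else 0 := by
    intro k k' hkA hk hk' hkk'
    have h1 := congrFun (C.coef_spec A hA g ⟨J, hJ⟩) (some ⟨{k, k'}, hkk'⟩)
    simp only [Matrix.mulVec, dotProduct, groupMatrix, exists_isTop_mem_iff rfl hk hk', ite_mul,
      one_mul, zero_mul] at h1
    rw [Finset.sum_coe_sort A fun h => if h ∈ k.1 then (C.coef A J h : ℚ) else 0,
      Finset.sum_ite_mem, Finset.inter_eq_right.2 hkA] at h1
    simp only [Pi.single_apply, Option.some.injEq, Subtype.mk.injEq, eq_comm (b := J)] at h1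
    split_ifs at h1 ⊢ <;> exact_mod_cast h1
  have hiff := isTop_compl_iff hr hA hkA hk'
  by_cases hk : IsTop A k
  · rw [htop k k' hkA hk (by tauto) hkk']
    simp [hk]
  · have h1 := htop k' k (by rw [hk']; exact Finset.sdiff_subset) (by tauto) hk
      (by rwa [Finset.pair_comm])
    -- For the user not connected to the last relay the sign flips: by the row of ones, its sum is
    -- minus the sum over the relays of its partner.
    have h2 := C.sum_coef hA hJ
    rw [← Finset.sum_sdiff hkA, ← hk', h1, Finset.pair_comm] at h2
    simp only [hk, if_false]
    split_ifs at h2 ⊢ <;> linarith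

theorem sum_codeword (q : ℕ) (d : User H r → Fin N) (F : Library N (PacketIdx H r P b))
    {A : Finset (Fin H)} (hr : 1 ≤ r) (hA : A.card = 2 * r)
    {g : Fin (groupCount r)} {k k' : User H r} (hkA : k.1 ⊆ A) (hk' : k'.1 = A \ k.1)
    (hkk' : {k, k'} ∈ C.group A g) (p : Fin P) :
    ∑ h ∈ k.1, C.codeword q d F A g h p =
      (if IsTop A k then (C.s : ZMod q) else -C.s) * toField q (pairMessage d F {k, k'} p) := by
  have h1 : ∀ J ∈ C.group A g, ∑ h ∈ k.1, (C.coef A J h : ZMod q) * toField q (pairMessage d F J p) =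
      if J = {k, k'} then (if IsTop A k then (C.s : ZMod q) else -C.s) *
        toField q (pairMessage d F {k, k'} p) else 0 := by
    intro J hJ
    rw [← Finset.sum_mul, ← Int.cast_sum, C.sum_coef_user hr hA hkA hk' hkk' hJ]
    split_ifs with h2
    · rw [h2]
    · rw [h2]; push_cast; rfl
    · simp
  simp only [codeword]
  rw [Finset.sum_comm, Finset.sum_congr rfl h1, Finset.sum_ite_eq' _ _, if_pos hkk']

/-- What user `k` receives. -/
def received (q : ℕ) (d : User H r → Fin N) (F : Library N (PacketIdx H r P b)) (k : User H r)
    (h : {h : Fin H // h ∈ k.1}) : DirectIdx r P b h.1 ⊕ CodedIdx r P q h.1 → Bit :=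
  (C.delivery N P b q d).enc F h.1

theorem toField_received {q : ℕ} [NeZero q] (d : User H r → Fin N)
    (F : Library N (PacketIdx H r P b)) (k : User H r) (h : {h : Fin H // h ∈ k.1})
    (A : {A : Finset (Fin H) // A.card = 2 * r ∧ h.1 ∈ A}) (g : Fin (groupCount r)) (p : Fin P) :
    toField q (fun t => C.received q d F k h (Sum.inr (A, g, p, t))) =
      C.codeword q d F A.1 g h.1 p := by
  change toField q (toBits (Nat.clog 2 q) (C.codeword q d F A.1 g h.1 p)) = _
  exact toField_toBits (Nat.le_pow_clog (by norm_num) q) _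

theorem codewordSum_received {q : ℕ} [NeZero q] (d : User H r → Fin N)
    (F : Library N (PacketIdx H r P b)) (hr : 1 ≤ r) {k k' : User H r} (hdisj : k.1 ∩ k'.1 = ∅)
    (p : Fin P) :
    C.codewordSum q k k' (C.received q d F k) p =
      (if IsTop (k.1 ∪ k'.1) k then (C.s : ZMod q) else -C.s) *
        toField q (pairMessage d F {k, k'} p) := by
  have hA : (k.1 ∪ k'.1).card = 2 * r := by
    rw [Finset.card_union_of_disjoint (Finset.disjoint_iff_inter_eq_empty.2 hdisj), k.2, k'.2]
    ring
  have hk' : k'.1 = (k.1 ∪ k'.1) \ k.1 := by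
    rw [Finset.union_sdiff_cancel_left (Finset.disjoint_iff_inter_eq_empty.2 hdisj)]
  have hkA : k.1 ⊆ k.1 ∪ k'.1 := Finset.subset_union_left
  obtain ⟨g, hg, huniq⟩ := C.group_cover _ hA _ (pair_mem_separatedPairsIn hr hkA hk')
  rw [← C.sum_codeword q d F hr hA hkA hk' hg p, codewordSum,
    ← Finset.sum_coe_sort k.1 fun h => C.codeword q d F (k.1 ∪ k'.1) g h p]
  refine Finset.sum_congr rfl fun h _ => ?_
  -- Only one term passes the test in `codewordSum`: the set is the union of the relays of both
  -- users, and the groups of that set are disjoint.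
  rw [Finset.sum_eq_single (⟨k.1 ∪ k'.1, hA, hkA h.2⟩ :
    {A : Finset (Fin H) // A.card = 2 * r ∧ h.1 ∈ A}), Finset.sum_eq_single g, if_pos ⟨rfl, hg⟩]
  · exact C.toField_received d F k h ⟨k.1 ∪ k'.1, hA, hkA h.2⟩ g p
  · intro g' _ hne
    rw [if_neg]
    rintro ⟨-, h'⟩
    exact hne (huniq g' h')
  · simp
  · intro A _ hne
    refine Finset.sum_eq_zero fun g' _ => if_neg ?_
    rintro ⟨h', -⟩
    exact hne (Subtype.ext h')
  · simp

theorem recoverMessage_received {q : ℕ} (hq : q.Prime) (hbq : 2 ^ b ≤ q)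
    (hs : (C.s : ZMod q) ≠ 0) (d : User H r → Fin N) (F : Library N (PacketIdx H r P b))
    (hr : 1 ≤ r) {k k' : User H r} (hne : k ≠ k') (p : Fin P) (j : Fin b) :
    C.recoverMessage q k k' (C.received q d F k) p j = pairMessage d F {k, k'} p j := by
  have := Fact.mk hq
  rw [recoverMessage]
  split_ifs with hcom htop
  · have h1 : ∀ h : {h : Fin H // h ∈ k.1}, (∑ x : DirectIdx r P b h.1,
        if x.1 = ({k, k'}, p, j) then C.received q d F k h (Sum.inl x) else 0) =
        if Carries {k, k'} h.1 p then pairMessage d F {k, k'} p j else 0 := by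
      intro h
      by_cases hc : Carries {k, k'} h.1 p
      · rw [if_pos hc, Finset.sum_eq_single
          (⟨({k, k'}, p, j), Finset.card_pair hne, hc⟩ : DirectIdx r P b h.1), if_pos rfl]
        · rfl
        · intro x _ hx
          exact if_neg fun h' => hx (Subtype.ext h')
        · simp
      · rw [if_neg hc]
        refine Finset.sum_eq_zero fun x _ => if_neg fun h' => hc ?_
        have := x.2.2
        rw [h'] at this
        exact this
    rw [Finset.sum_congr rfl fun h _ => h1 h]
    obtain ⟨h, ⟨hh, hpos⟩, huniq⟩ := existsUnique_card_filter_lt_eq (commonRelays {k, k'})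
      (i := (p : ℕ) % (commonRelays {k, k'}).card)
      (Nat.mod_lt _ (by rw [commonRelays_pair]; exact Finset.card_pos.2 hcom))
    have hhk : h ∈ k.1 := by
      rw [commonRelays_pair] at hh
      exact (Finset.mem_inter.1 hh).1
    rw [Finset.sum_eq_single (⟨h, hhk⟩ : {h : Fin H // h ∈ k.1}), if_pos ⟨hh, hpos⟩]
    · intro h' _ hne'
      exact if_neg fun hc => hne' (Subtype.ext (huniq h'.1 hc))
    · simp
  · rw [C.codewordSum_received d F hr (Finset.not_nonempty_iff_eq_empty.1 hcom), if_pos htop,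
      inv_mul_cancel_left₀ hs, toBits_toField hbq]
  · rw [C.codewordSum_received d F hr (Finset.not_nonempty_iff_eq_empty.1 hcom), if_neg htop,
      inv_mul_cancel_left₀ (neg_ne_zero.2 hs), toBits_toField hbq]

/-- Every user recovers the file it demands. -/
theorem output_delivery {q : ℕ} (hq : q.Prime) (hbq : 2 ^ b ≤ q) (hs : (C.s : ZMod q) ≠ 0)
    (hr : 1 ≤ r) (d : User H r → Fin N) (F : Library N (PacketIdx H r P b)) (k : User H r) :
    (C.delivery N P b q d).output F k = F (d k) := by
  funext ⟨k', p, j⟩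
  change (if k' = k then F (d k) (k, p, j) else
    C.recoverMessage q k k' (C.received q d F k) p j - F (d k') (k, p, j)) = F (d k) (k', p, j)
  split_ifs with h
  · rw [h]
  · rw [C.recoverMessage_received hq hbq hs d F hr (Ne.symm h), pairMessage_pair d F (Ne.symm h),
      add_sub_cancel_right]

end InterferenceCode

end Decoding

/-! ## The load -/

section Load

variable {N H r P b : ℕ}

theorem mul_card_filter_mod_eq {c P i : ℕ} (hc : c ∣ P) (hi : i < c) :
    c * (Finset.univ.filter fun p : Fin P => i = (p : ℕ) % c).card = P := by
  have h1 : (Finset.univ.filter fun p : Fin P => i = (p : ℕ) % c).card =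
      P.count (· ≡ i [MOD c]) := by
    rw [Nat.count_eq_card_filter_range, Finset.card_filter, Finset.card_filter,
      Fin.sum_univ_eq_sum_range fun p => if i = p % c then 1 else 0]
    refine Finset.sum_congr rfl fun p _ => ?_
    simp only [Nat.ModEq, Nat.mod_eq_of_lt hi, eq_comm]
  rw [h1, Nat.count_modEq_card _ (by omega), Nat.mod_eq_zero_of_dvd hc]
  simpa using Nat.mul_div_cancel' hc

theorem card_user (H r : ℕ) : Fintype.card (User H r) = H.choose r := by
  rw [Fintype.card_finset_len, Fintype.card_fin]

/-- Incidences of users with pairs, counted twice: a user has one partner for each `r`-subset of the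
complement of its relays. -/
theorem two_mul_card_separatedPairs (hr : 1 ≤ r) :
    2 * (separatedPairs H r).card = H.choose r * (H - r).choose r := by
  have h1 : ∀ k : User H r, ((separatedPairs H r).filter fun J => k ∈ J).card =
      (H - r).choose r := by
    intro k
    have h2 : k.1ᶜ.card = H - r := by rw [Finset.card_compl, Fintype.card_fin, k.2]
    rw [← h2, ← Finset.card_powersetCard]
    symm
    have hdisj : ∀ S ∈ k.1ᶜ.powersetCard r, k.1 ∩ S = ∅ := fun S hS =>
      Finset.disjoint_iff_inter_eq_empty.1 (Finset.subset_compl_iff_disjoint_left.1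
        (Finset.mem_powersetCard.1 hS).1)
    have hne : ∀ (S : Finset (Fin H)) (hS : S ∈ k.1ᶜ.powersetCard r),
        k ≠ ⟨S, (Finset.mem_powersetCard.1 hS).2⟩ := by
      intro S hS hkS
      have h3 := hdisj S hS
      have h4 := (Finset.mem_powersetCard.1 hS).2
      rw [hkS, Finset.inter_self] at h3
      change S = ∅ at h3
      rw [h3, Finset.card_empty] at h4
      omega
    refine Finset.card_bij (fun S hS => {k, ⟨S, (Finset.mem_powersetCard.1 hS).2⟩}) ?_ ?_ ?_
    · intro S hS
      simp only [separatedPairs, Finset.mem_filter, Finset.mem_univ, true_and, commonRelays_pair]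
      exact ⟨⟨Finset.card_pair (hne S hS), hdisj S hS⟩, by simp⟩
    · intro S hS T hT h
      have h3 : (⟨S, (Finset.mem_powersetCard.1 hS).2⟩ : User H r) ∈
          ({k, ⟨T, (Finset.mem_powersetCard.1 hT).2⟩} : Finset (User H r)) := by
        rw [← h]; simp
      rcases Finset.mem_insert.1 h3 with h3 | h3
      · exact absurd h3.symm (hne S hS)
      · exact congrArg Subtype.val (Finset.mem_singleton.1 h3)
    · intro J hJ
      simp only [separatedPairs, Finset.mem_filter, Finset.mem_univ, true_and] at hJ
      obtain ⟨⟨hc, hcom⟩, hk⟩ := hJ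
      obtain ⟨k', hk'⟩ := Finset.card_eq_one.1
        (by rw [Finset.card_erase_of_mem hk, hc] : (J.erase k).card = 1)
      have hJ' : J = {k, k'} := by rw [← Finset.insert_erase hk, hk']
      rw [hJ', commonRelays_pair] at hcom
      exact ⟨k'.1, Finset.mem_powersetCard.2 ⟨Finset.subset_compl_iff_disjoint_left.2
        (Finset.disjoint_iff_inter_eq_empty.2 hcom), k'.2⟩, hJ'.symm⟩
  have h2 : ∑ J ∈ separatedPairs H r, ∑ k : User H r, (if k ∈ J then 1 else 0) =
      2 * (separatedPairs H r).card := by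
    rw [Finset.sum_congr rfl (g := fun _ => 2), Finset.sum_const, smul_eq_mul, mul_comm]
    intro J hJ
    simp only [separatedPairs, Finset.mem_filter] at hJ
    simp [hJ.2.1]
  rw [← h2, Finset.sum_comm, ← card_user H r]
  simp only [← Finset.card_filter, h1]
  simp

/-- The reason for requiring `r.factorial ∣ P`: there are at most `r` common relays, so the packets
can be shared equally among them. -/
theorem card_commonRelays_dvd_factorial {J : Finset (User H r)} (hJ : J.Nonempty)
    {h : Fin H} (hh : h ∈ commonRelays J) : (commonRelays J).card ∣ r.factorial := by
  obtain ⟨k, hk⟩ := hJ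
  refine Nat.dvd_factorial (Finset.card_pos.2 ⟨h, hh⟩) ?_
  refine (Finset.card_le_card fun x hx => ?_).trans_eq k.2
  simp only [commonRelays, Finset.mem_filter, Finset.mem_univ, true_and] at hx
  exact hx k hk

/-- The share of pair messages that is sent directly to relay `h`. -/
noncomputable def directShare (r : ℕ) (h : Fin H) : ℝ :=
  ∑ J : Finset (User H r), if J.card = 2 ∧ h ∈ commonRelays J then
    ((commonRelays J).card : ℝ)⁻¹ else 0

/-- The transposition of the two relays permutes the users and the pairs and preserves the numbers
of common relays. -/
theorem directShare_eq_directShare (r : ℕ) (h h' : Fin H) :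
    directShare r h = directShare r h' := by
  let σ : Equiv.Perm (Fin H) := Equiv.swap h h'
  let e : User H r ≃ User H r := (Equiv.finsetCongr σ).subtypeEquiv fun S => by
    simp [Equiv.finsetCongr_apply]
  have hmem : ∀ (k : User H r) x, σ x ∈ (e k).1 ↔ x ∈ k.1 := by
    intro k x
    simp [e, Equiv.finsetCongr_apply]
  have hcom : ∀ J : Finset (User H r), commonRelays (J.map e.toEmbedding) =
      (commonRelays J).map σ.toEmbedding := by
    intro J
    ext x
    obtain ⟨y, rfl⟩ := σ.surjective x
    change σ.toEmbedding y ∈ _ ↔ σ.toEmbedding y ∈ _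
    rw [Finset.mem_map']
    simp only [commonRelays, Finset.mem_filter, Finset.mem_univ, true_and, Finset.mem_map,
      forall_exists_index, and_imp, forall_apply_eq_imp_iff₂, Equiv.coe_toEmbedding, hmem]
  refine Fintype.sum_equiv (Equiv.finsetCongr e) _ _ fun J => ?_
  have h1 : h' ∈ (commonRelays J).map σ.toEmbedding ↔ h ∈ commonRelays J := by
    rw [show h' = σ.toEmbedding h from (Equiv.swap_apply_left h h').symm, Finset.mem_map']
  rw [Equiv.finsetCongr_apply, hcom, Finset.card_map, Finset.card_map]
  simp only [h1]

/-- A pair with `c > 0` common relays contributes `1 / c` to each of them, so `1` in total. -/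
theorem sum_directShare :
    ∑ h : Fin H, directShare r h = ((H.choose r).choose 2 : ℝ) - (separatedPairs H r).card := by
  have h1 : ∀ J : Finset (User H r), (∑ h : Fin H, if J.card = 2 ∧ h ∈ commonRelays J then
      ((commonRelays J).card : ℝ)⁻¹ else 0) =
      (if J.card = 2 then 1 else 0) - if J ∈ separatedPairs H r then 1 else 0 := by
    intro J
    simp only [separatedPairs, Finset.mem_filter, Finset.mem_univ, true_and]
    by_cases hJ : J.card = 2
    · rcases Finset.eq_empty_or_nonempty (commonRelays J) with hc | hc
      · simp [hJ, hc]
      · simp [hJ, hc.ne_empty]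
    · simp [hJ]
  simp only [directShare]
  rw [Finset.sum_comm, Finset.sum_congr rfl fun J _ => h1 J, Finset.sum_sub_distrib]
  congr 1
  · rw [← card_user H r, ← Finset.card_univ, ← Finset.card_powersetCard, Finset.sum_boole]
    congr 2
    ext J
    simp
  · simp

theorem directShare_eq (hr : 1 ≤ r) (h : Fin H) :
    directShare r h = H.choose r *
      (1 / (2 * (H : ℝ)) * ((H.choose r : ℝ) - 1 - ((H - r).choose r : ℝ))) := by
  have hH : (H : ℝ) ≠ 0 := by
    have := h.pos
    positivity
  have h1 := sum_directShare (H := H) (r := r)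
  rw [Finset.sum_congr rfl fun h' _ => directShare_eq_directShare r h' h, Finset.sum_const,
    Finset.card_univ, Fintype.card_fin, nsmul_eq_mul, Nat.cast_choose_two] at h1
  have h2 : (2 : ℝ) * (separatedPairs H r).card = H.choose r * (H - r).choose r := by
    exact_mod_cast two_mul_card_separatedPairs hr
  field_simp
  linarith

theorem card_directIdx (hP : r.factorial ∣ P) (h : Fin H) :
    (Fintype.card (DirectIdx r P b h) : ℝ) = directShare r h * (P * b) := by
  have h1 : ∀ J : Finset (User H r), ((∑ x : Fin P × Fin b,
      if J.card = 2 ∧ Carries J h x.1 then 1 else 0 : ℕ) : ℝ) =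
      (if J.card = 2 ∧ h ∈ commonRelays J then ((commonRelays J).card : ℝ)⁻¹ else 0) *
        (P * b) := by
    intro J
    rw [Fintype.sum_prod_type]
    by_cases hJ : J.card = 2 ∧ h ∈ commonRelays J
    · obtain ⟨hJ2, hh⟩ := hJ
      have hlt : ((commonRelays J).filter fun x => x < h).card < (commonRelays J).card := by
        refine Finset.card_lt_card ⟨Finset.filter_subset _ _, fun hsub => ?_⟩
        simpa using hsub hh
      have h2 := mul_card_filter_mod_eq ((card_commonRelays_dvd_factorial
        (Finset.card_pos.1 (by omega)) hh).trans hP) hlt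
      have hc : ((commonRelays J).card : ℝ) ≠ 0 := by
        have : 0 < (commonRelays J).card := by omega
        positivity
      simp only [hJ2, hh, Carries, true_and, if_true, Finset.sum_const, Finset.card_univ,
        Fintype.card_fin, smul_eq_mul, ← Finset.mul_sum, ← Finset.card_filter]
      rw [eq_inv_mul_iff_mul_eq₀ hc]
      conv_rhs => rw [← h2]
      push_cast
      ring
    · have h2 : ∀ p : Fin P, ¬ (J.card = 2 ∧ Carries J h p) := fun p hp => hJ ⟨hp.1, hp.2.1⟩
      simp [hJ, h2]
  rw [Fintype.card_subtype, Finset.card_filter, Fintype.sum_prod_type, Nat.cast_sum, directShare,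
    Finset.sum_mul]
  exact Finset.sum_congr rfl fun J _ => h1 J

theorem card_codedIdx (hr : 1 ≤ r) (q : ℕ) (h : Fin H) :
    Fintype.card (CodedIdx r P q h) =
      (H - 1).choose (2 * r - 1) * (groupCount r * (P * Nat.clog 2 q)) := by
  have h1 : Fintype.card {A : Finset (Fin H) // A.card = 2 * r ∧ h ∈ A} =
      (H - 1).choose (2 * r - 1) := by
    have h2 : ((Finset.univ : Finset (Fin H)).erase h).card = H - 1 := by
      rw [Finset.card_erase_of_mem (Finset.mem_univ h), Finset.card_univ, Fintype.card_fin]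
    rw [Fintype.card_subtype, ← h2, ← Finset.card_powersetCard]
    refine Finset.card_nbij' (fun A => A.erase h) (insert h) ?_ ?_ ?_ ?_
    · intro A hA
      obtain ⟨-, hA, hh⟩ := Finset.mem_filter.1 (Finset.mem_coe.1 hA)
      refine Finset.mem_coe.2 (Finset.mem_powersetCard.2
        ⟨Finset.erase_subset_erase _ (Finset.subset_univ _), ?_⟩)
      rw [Finset.card_erase_of_mem hh, hA]
    · intro A hA
      obtain ⟨hA, hc⟩ := Finset.mem_powersetCard.1 (Finset.mem_coe.1 hA)
      have hh : h ∉ A := fun hh => by simpa using hA hh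
      refine Finset.mem_coe.2 (Finset.mem_filter.2 ⟨Finset.mem_univ _, ?_, by simp⟩)
      rw [Finset.card_insert_of_notMem hh, hc]
      omega
    · intro A hA
      exact Finset.insert_erase (Finset.mem_filter.1 (Finset.mem_coe.1 hA)).2.2
    · intro A hA
      exact Finset.erase_insert fun hh => by
        simpa using (Finset.mem_powersetCard.1 (Finset.mem_coe.1 hA)).1 hh
  rw [Fintype.card_prod, Fintype.card_prod, Fintype.card_prod, h1, Fintype.card_fin,
    Fintype.card_fin, Fintype.card_fin]

theorem card_packetIdx : Fintype.card (PacketIdx H r P b) = H.choose r * (P * b) := by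
  rw [Fintype.card_prod, Fintype.card_prod, card_user, Fintype.card_fin, Fintype.card_fin]

theorem card_subfilePlacement (hH : r ≤ H) (k : User H r) :
    ((subfilePlacement N H r P b k).card : ℝ) =
      (N : ℝ) / (H.choose r : ℝ) * (Fintype.card (PacketIdx H r P b) : ℝ) := by
  have h1 : subfilePlacement N H r P b k =
      Finset.univ ×ˢ ({k} ×ˢ (Finset.univ : Finset (Fin P × Fin b))) := by
    ext ⟨i, k', p, j⟩
    simp [subfilePlacement, eq_comm]
  have hK : (H.choose r : ℝ) ≠ 0 := by exact_mod_cast (Nat.choose_pos hH).ne'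
  rw [h1, card_packetIdx]
  simp only [Finset.card_product, Finset.card_univ, Finset.card_singleton, Fintype.card_prod,
    Fintype.card_fin]
  push_cast
  field_simp

/-- Relays forward everything, so only the links from the server matter. A codeword needs at most `b
+ 1` bits. Counting `b` of them gives exactly the coded part of the load, and the last term collects
the extra bits. -/
theorem maxLinkBits_delivery_le (C : InterferenceCode H r) (hr : 1 ≤ r) (hH : 2 * r ≤ H) {q : ℕ}
    (hq : q ≤ 2 ^ (b + 1)) (hP : r.factorial ∣ P) (d : User H r → Fin N) :
    ((C.delivery N P b q d).maxLinkBits : ℝ) ≤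
      interferenceLoad H r * (H.choose r * (P * b)) +
        (H - 1).choose (2 * r - 1) * groupCount r * P := by
  obtain ⟨h, -, hh⟩ := Finset.exists_mem_eq_sup (Finset.univ : Finset (Fin H))
    ⟨⟨0, by omega⟩, Finset.mem_univ _⟩ fun h : Fin H =>
    max (@Fintype.card ((C.delivery N P b q d).relayIdx h) ((C.delivery N P b q d).relayFintype h))
      ((Finset.univ.filter fun k : User H r => h ∈ k.1).sup fun k =>
        @Fintype.card ((C.delivery N P b q d).linkIdx h k)
          ((C.delivery N P b q d).linkFintype h k))
  have h1 : (C.delivery N P b q d).maxLinkBits ≤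
      Fintype.card (DirectIdx r P b h) + Fintype.card (CodedIdx r P q h) := by
    rw [Delivery.maxLinkBits, hh, ← Fintype.card_sum]
    exact max_le le_rfl (Finset.sup_le fun _ _ => le_rfl)
  have h2 : Fintype.card (CodedIdx r P q h) ≤
      (H - 1).choose (2 * r - 1) * (groupCount r * (P * (b + 1))) := by
    rw [card_codedIdx hr]
    gcongr
    exact Nat.clog_le_of_le_pow hq
  have h3 : ((C.delivery N P b q d).maxLinkBits : ℝ) ≤
      Fintype.card (DirectIdx r P b h) +
        (H - 1).choose (2 * r - 1) * (groupCount r * (P * (b + 1))) := by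
    exact_mod_cast h1.trans (Nat.add_le_add_left h2 _)
  have h4 : ((2 * r - 1).choose (r - 1) : ℝ) = (2 * (r : ℝ) - 1) * groupCount r := by
    rw [choose_eq_two_mul_sub_one_mul_groupCount hr, Nat.cast_mul, Nat.cast_sub (by omega)]
    push_cast
    ring
  have hK : (H.choose r : ℝ) ≠ 0 := by exact_mod_cast (Nat.choose_pos (by omega)).ne'
  have hr' : (2 * (r : ℝ) - 1) ≠ 0 := by
    have : (1 : ℝ) ≤ r := by exact_mod_cast hr
    linarith
  refine h3.trans_eq ?_
  have h5 : (2 * (r : ℝ) - 1) * groupCount r / ((2 * (r : ℝ) - 1) * H.choose r) *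
      (H - 1).choose (2 * r - 1) * (H.choose r * (P * b)) =
      (H - 1).choose (2 * r - 1) * groupCount r * (P * b) := by
    field_simp
  rw [card_directIdx hP, directShare_eq hr, interferenceLoad, h4, add_mul, h5]
  ring

/-- The interference elimination scheme achieves its load. -/
theorem interferenceCode_achieves (C : InterferenceCode H r) (N : ℕ) (hr : 1 ≤ r)
    (hH : 2 * r ≤ H) {δ : ℝ} (hδ : 0 < δ) :
    ∃ b₀ : ℕ, ∀ b : ℕ, b₀ ≤ b → ∀ P : ℕ, 0 < P → r.factorial ∣ P →
      ∃ q : ℕ, q.Prime ∧ 2 ^ b ≤ q ∧ (C.s : ZMod q) ≠ 0 ∧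
        (∀ k, ((subfilePlacement N H r P b k).card : ℝ) ≤
          (N : ℝ) / (H.choose r : ℝ) * (Fintype.card (PacketIdx H r P b) : ℝ)) ∧
        ∀ d : User H r → Fin N,
          (∀ (F : Library N (PacketIdx H r P b)) (k : User H r),
            (C.delivery N P b q d).output F k = F (d k)) ∧
          (C.delivery N P b q d).maxLinkLoad ≤ interferenceLoad H r + δ := by
  -- The first bound gives `|s| < b < 2 ^ b < q`, so `q` does not divide `s`, and also `0 < b`. The
  -- second makes the extra bits per packet at most `δ * b`.
  refine ⟨max (C.s.natAbs + 1) ⌈(H - 1).choose (2 * r - 1) * groupCount r / δ⌉₊,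
    fun b hb P hP hPr => ?_⟩
  -- Bertrand's postulate keeps the binary length of field elements at most `b + 1`.
  obtain ⟨q, hq, hlt, hle⟩ := Nat.exists_prime_lt_and_le_two_mul (2 ^ b) (by positivity)
  have hs : (C.s : ZMod q) ≠ 0 := by
    rw [Ne, ZMod.intCast_zmod_eq_zero_iff_dvd, ← Int.natAbs_dvd_natAbs, Int.natAbs_natCast]
    intro hdvd
    have h1 := Nat.le_of_dvd (Int.natAbs_pos.2 C.s_ne_zero) hdvd
    have h2 := b.lt_two_pow_self
    have h3 := (le_max_left _ _).trans hb
    omega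
  refine ⟨q, hq, hlt.le, hs, fun k => (card_subfilePlacement (by omega) k).le, fun d =>
    ⟨fun F k => C.output_delivery hq hlt.le hs hr d F k, ?_⟩⟩
  have hb0 : 0 < b := by
    have := (le_max_left _ _).trans hb
    omega
  have hK : (1 : ℝ) ≤ H.choose r := by exact_mod_cast Nat.choose_pos (by omega : r ≤ H)
  have hP' : (0 : ℝ) < P := by exact_mod_cast hP
  have hb' : (0 : ℝ) < b := by exact_mod_cast hb0
  have hbδ : ((H - 1).choose (2 * r - 1) * groupCount r : ℝ) ≤ δ * b := by
    have h1 := (Nat.le_ceil _).trans (Nat.cast_le.2 ((le_max_right _ _).trans hb) : (_ : ℝ) ≤ b)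
    rwa [div_le_iff₀ hδ, mul_comm (b : ℝ)] at h1
  rw [Delivery.maxLinkLoad, card_packetIdx, div_le_iff₀ (by push_cast; positivity)]
  refine (maxLinkBits_delivery_le C hr hH (hle.trans_eq (by ring)) hPr d).trans ?_
  push_cast
  rw [add_mul]
  refine add_le_add_right ?_ _
  calc ((H - 1).choose (2 * r - 1) * groupCount r * P : ℝ) ≤ δ * b * P := by gcongr
    _ ≤ δ * b * P * H.choose r := le_mul_of_one_le_right (by positivity) hK
    _ = δ * (H.choose r * (P * b)) := by ring

end Load

/-! ### From labelled files and exact delivery to achievable loads -/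

section Relabel

variable {N H r : ℕ} {α β : Type}

/-- The same placement with other labels for the bits of the files. -/
def UncodedPlacement.relabel (e : α ≃ β) (Z : UncodedPlacement N H r β) :
    UncodedPlacement N H r α :=
  fun k => (Z k).map ((Equiv.refl _).prodCongr e.symm).toEmbedding

theorem UncodedPlacement.mem_relabel (e : α ≃ β) (Z : UncodedPlacement N H r β) {k : User H r}
    {x : Fin N × β} (hx : x ∈ Z k) : (x.1, e.symm x.2) ∈ Z.relabel e k :=
  Finset.mem_map_of_mem ((Equiv.refl _).prodCongr e.symm).toEmbedding hx

/-- The same delivery phase with other labels for the bits of the files. -/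
def Delivery.relabel (e : α ≃ β) {Z : UncodedPlacement N H r β} (D : Delivery Z) :
    Delivery (Z.relabel e) where
  relayIdx := D.relayIdx
  linkIdx := D.linkIdx
  relayFintype := D.relayFintype
  linkFintype := D.linkFintype
  enc F := D.enc fun i x => F i (e.symm x)
  fwd := D.fwd
  dec k c y := fun i =>
    D.dec k (fun z => c ⟨(z.1.1, e.symm z.1.2), UncodedPlacement.mem_relabel e Z z.2⟩) y (e i)

theorem Delivery.output_relabel (e : α ≃ β) {Z : UncodedPlacement N H r β} (D : Delivery Z)
    (F : Library N α) (k : User H r) (i : α) :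
    (D.relabel e).output F k i = D.output (fun j x => F j (e.symm x)) k (e i) := rfl

theorem Delivery.errorProb_eq_zero {Z : UncodedPlacement N H r β} (D : Delivery Z)
    (d : User H r → Fin N) (h : ∀ F k, D.output F k = F (d k)) : D.errorProb d = 0 := by
  have : IsEmpty {F : Library N β // ∃ k, D.output F k ≠ F (d k)} :=
    ⟨fun ⟨F, k, hk⟩ => hk (h F k)⟩
  rw [Delivery.errorProb, Nat.card_of_isEmpty, Nat.cast_zero, zero_div]

/-- A load at which every demand vector is served without error is achievable. -/
theorem achievableUncoded_of_exact [Fintype β] [Nonempty β] (Z : UncodedPlacement N H r β)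
    {M R : ℝ} (hZ : ∀ k, ((Z k).card : ℝ) ≤ M * Fintype.card β)
    (hD : ∀ d : User H r → Fin N, ∃ D : Delivery Z,
      (∀ F k, D.output F k = F (d k)) ∧ D.maxLinkLoad ≤ R) :
    AchievableUncoded N H r M R := by
  intro ε hε
  let e : Fin (Fintype.card β) ≃ β := (Fintype.equivFin β).symm
  refine ⟨Fintype.card β, Fintype.card_pos, Z.relabel e, fun k => ?_, fun d => ?_⟩
  · rw [UncodedPlacement.relabel, Finset.card_map]
    exact hZ k
  · obtain ⟨D, hout, hload⟩ := hD d
    refine ⟨D.relabel e, ?_, ?_⟩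
    · rw [Delivery.maxLinkLoad, Fintype.card_fin]
      exact hload
    · rw [Delivery.errorProb_eq_zero]
      · exact hε.le
      · intro F k
        funext i
        rw [Delivery.output_relabel, hout, Equiv.symm_apply_apply]

end Relabel

end CombinationNetwork

theorem mainTheorem7 (N H r : ℕ) (hr : 1 ≤ r) (hH : 2 * r ≤ H) (hN : H.choose r ≤ N) :
    CombinationNetwork.optimalLoadUncoded N H r ((N : ℝ) / (H.choose r : ℝ)) ≤
        ((CombinationNetwork.interferenceLoad H r : ℝ) : EReal) ∧
    (((∃ p v : ℕ, p.Prime ∧ 1 ≤ v ∧ 2 * r - 1 = p ^ v) ∨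
        (∃ p q : ℕ, p.Prime ∧ q.Prime ∧ p ≠ q ∧ 2 * r - 1 = p * q)) →
      ∃ C : CombinationNetwork.InterferenceCode H r,
        ∀ δ : ℝ, 0 < δ → ∃ b₀ : ℕ, ∀ b : ℕ, b₀ ≤ b → ∀ P : ℕ, 0 < P → r.factorial ∣ P →
          ∃ q : ℕ, q.Prime ∧ 2 ^ b ≤ q ∧ (C.s : ZMod q) ≠ 0 ∧
            (∀ k, ((CombinationNetwork.subfilePlacement N H r P b k).card : ℝ) ≤
              (N : ℝ) / (H.choose r : ℝ) *
                (Fintype.card (CombinationNetwork.PacketIdx H r P b) : ℝ)) ∧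
            ∀ d : CombinationNetwork.User H r → Fin N,
              (∀ (F : CombinationNetwork.Library N (CombinationNetwork.PacketIdx H r P b))
                (k : CombinationNetwork.User H r),
                  (C.delivery N P b q d).output F k = F (d k)) ∧
              (C.delivery N P b q d).maxLinkLoad ≤
                CombinationNetwork.interferenceLoad H r + δ) := by
  obtain ⟨C⟩ := CombinationNetwork.nonempty_interferenceCode H hr
  refine ⟨?_, fun _ => ⟨C, fun δ hδ =>
    CombinationNetwork.interferenceCode_achieves C N hr hH hδ⟩⟩
  -- The scheme reaches the load only up to `δ`, which suffices for an infimum: every real `z` above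
  -- it is achievable, with `δ` the gap.
  rw [← EReal.le_of_forall_lt_iff_le]
  intro z hz
  have hz' : CombinationNetwork.interferenceLoad H r < z := by exact_mod_cast hz
  obtain ⟨b₀, hb₀⟩ :=
    CombinationNetwork.interferenceCode_achieves C N hr hH (sub_pos.2 hz')
  obtain ⟨q, -, -, -, hcache, hdel⟩ :=
    -- The choice `b₀ + 1` instead of `b₀` ensures a positive file size.
    hb₀ (b₀ + 1) (by omega) r.factorial r.factorial_pos dvd_rfl
  have hpos : 0 < Fintype.card (CombinationNetwork.PacketIdx H r r.factorial (b₀ + 1)) := by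
    rw [CombinationNetwork.card_packetIdx]
    have := Nat.choose_pos (by omega : r ≤ H)
    have := r.factorial_pos
    positivity
  have := Fintype.card_pos_iff.1 hpos
  exact iInf₂_le z (CombinationNetwork.achievableUncoded_of_exact _ hcache fun d =>
    ⟨_, (hdel d).1, (hdel d).2.trans_eq (by ring)⟩)
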